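/- Let $X$ be a measurable space. A concept is a measurable map $X\to\{0,1\}$, and a concept class is a set $C$ of concepts. For a probability measure $\mu$ on $X$ write $\mathrm{error}_\mu(c,h)=\Pr_{x\sim\mu}[h(x)\neq c(x)]$. $\mathrm{VC}(C)$ is the largest size of a finite set $B\subseteq X$ on which $C$ realizes all $2^{|B|}$ labelings ($\infty$ if there is no largest one, $0$ if $C=\emptyset$). An $(\alpha,\beta)$-probabilistic representation of $C$ is a family of finite sets of concepts $H_1,\dots,H_r$ with a probability distribution $P$ on $\{1,\dots,r\}$ such that for every $c\in C$ and every probability measure $\mu$ on $X$, $\Pr_{i\sim P}[\exists h\in H_i:\ \mathrm{error}_\mu(c,h)\le\alpha]\ge 1-\beta$. The representation dimension $\mathrm{RepDim}(C)$ is the minimum of $\max_i \ln|H_i|$ (with $\ln 0$ read as $0$) over all $(\frac14,\frac14)$-probabilistic representations of $C$, and $\infty$ if there is none (it is finite whenever $X$ is finite). For $m\le n$, an $(\alpha,\beta,\epsilon,0,n,m)$-PSSL (pure-private semi-supervised learner) for $C$ is a randomized algorithm $\mathcal A$ that maps a database in $(X\times\{0,1,\bot\})^n$ to a concept (not necessarily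 in $C$) such that (1) for any two databases $S_1,S_2$ that differ in exactly one entry and every set $F$ of outputs, $\Pr[\mathcal A(S_1)\in F]\le e^{\epsilon}\Pr[\mathcal A(S_2)\in F]$; and (2) for every $c\in C$ and every probability measure $\mu$ on $X$, if $D=(x_i,y_i)_{i=1}^n$ where $x_1,\dots,x_n$ are i.i.d. from $\mu$, $y_i=c(x_i)$ for $i\le m$ and $y_i=\bot$ for $i>m$, then $\Pr[\mathrm{error}_\mu(c,\mathcal A(D))>\alpha]\le\beta$, the probability being over the sample and the coins of $\mathcal A$. **Corollary.** There are functions $K_1,K_2:\mathbb R^3\to[0,\infty)$ such that for every measurable space $X$, every concept class $C$ over $X$ with $\mathrm{RepDim}(C)<\infty$, and all $\alpha,\beta,\epsilon>0$, there are $m\le n$ with $$m\le K_1(\alpha,\beta,\epsilon)\cdot\mathrm{VC}(C),\qquad n\le K_2(\alpha,\beta,\epsilon)\cdot\mathrm{RepDim}(C),$$ and an $(\alpha,\beta,\epsilon,0,n,m)$-PSSL for $C$. -/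

import Mathlib

open MeasureTheory ProbabilityTheory
open scoped ENNReal NNReal

/-- A concept (or hypothesis) over `X`: a (measurable) predicate `X → {0,1}`. -/
structure BoolConcept (X : Type*) [MeasurableSpace X] where
  toFun : X → Bool
  measurable_toFun : Measurable toFun

instance (X : Type*) [MeasurableSpace X] : CoeFun (BoolConcept X) (fun _ => X → Bool) :=
  ⟨BoolConcept.toFun⟩

/-- Every set of hypotheses is an event of a randomized algorithm that outputs hypotheses. -/
instance (X : Type*) [MeasurableSpace X] : MeasurableSpace (BoolConcept X) := ⊤

/-- A label is `0`, `1` or `⊥`; the label `⊥` (no label) is `none`. -/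
abbrev Label : Type := Option Bool

instance : MeasurableSpace Label := ⊤

/-- Partially labeled databases with `n` entries over the domain `X`. -/
abbrev PartialDatabase (X : Type*) (n : ℕ) : Type _ := Fin n → X × Label

/-- The generalization error `Pr_{x ∼ μ}[h(x) ≠ c(x)]`. -/
noncomputable def genError {X : Type*} [MeasurableSpace X] (μ : Measure X)
    (c h : BoolConcept X) : ℝ :=
  μ.real {x | h x ≠ c x}

/-- The database on the points `x` in which the first `m` entries are labeled by `c` and the
other ones are unlabeled. -/
def partialSample {X : Type*} [MeasurableSpace X] {n : ℕ} (m : ℕ) (c : BoolConcept X)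
    (x : Fin n → X) : PartialDatabase X n :=
  fun i => (x i, if i.val < m then some (c (x i)) else none)

/-- Two databases are neighboring if they differ in exactly one entry. -/
def Neighboring {Z : Type*} {n : ℕ} (S₁ S₂ : Fin n → Z) : Prop :=
  ∃ i, S₁ i ≠ S₂ i ∧ ∀ j, j ≠ i → S₁ j = S₂ j

/-- `(ε, δ)`-differential privacy of a randomized algorithm (a Markov kernel from databases to
outputs). -/
def IsDifferentiallyPrivate {Z O : Type*} [MeasurableSpace Z] [MeasurableSpace O] {n : ℕ}
    (ε δ : ℝ) (A : Kernel (Fin n → Z) O) : Prop :=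
  ∀ S₁ S₂ : Fin n → Z, Neighboring S₁ S₂ → ∀ F : Set O, MeasurableSet F →
    A S₁ F ≤ ENNReal.ofReal (Real.exp ε) * A S₂ F + ENNReal.ofReal δ

/-- `(α, β, n, m)`-semi-supervised (improper) learner for the concept class `C`: on `n` i.i.d.
examples, the first `m` of which are labeled by a target concept `c ∈ C`, the probability (over
the sample and the coins of `A`) that the output has error more than `α` is at most `β`. -/
def IsSSL {X : Type*} [MeasurableSpace X] (α β : ℝ) (n m : ℕ) (C : Set (BoolConcept X))
    (A : Kernel (PartialDatabase X n) (BoolConcept X)) : Prop :=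
  m ≤ n ∧ ∀ c ∈ C, ∀ (μ : Measure X) [IsProbabilityMeasure μ],
    ∫⁻ x, A (partialSample m c x) {h | α < genError μ c h} ∂(Measure.pi fun _ : Fin n => μ)
      ≤ ENNReal.ofReal β

/-- `(α, β, ε, δ, n, m)`-private semi-supervised (improper) learner for `C`. -/
def IsPSSL {X : Type*} [MeasurableSpace X] (α β ε δ : ℝ) (n m : ℕ) (C : Set (BoolConcept X))
    (A : Kernel (PartialDatabase X n) (BoolConcept X)) : Prop :=
  IsSSL α β n m C A ∧ IsDifferentiallyPrivate ε δ A

/-- The finite set `B` is shattered by `C`: all dichotomies on `B` are realized by `C`. -/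
def IsShattered {X : Type*} [MeasurableSpace X] (C : Set (BoolConcept X)) (B : Finset X) : Prop :=
  ∀ z : X → Bool, ∃ c ∈ C, ∀ b ∈ B, c b = z b

/-- The Vapnik-Chervonenkis dimension. -/
noncomputable def vcDimension {X : Type*} [MeasurableSpace X] (C : Set (BoolConcept X)) : ℕ∞ :=
  ⨆ (B : Finset X) (_ : IsShattered C B), (B.card : ℕ∞)

/-- The family `H₁, …, H_r` of finite hypothesis classes together with the distribution `P` on
its indices is an `(α, β)`-probabilistic representation of `C`: for every `c ∈ C` and every
distribution `μ`, with probability at least `1 - β` over `i ∼ P` the class `H_i` contains a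
hypothesis with error at most `α`. -/
def IsProbRepresentation {X : Type*} [MeasurableSpace X] (α β : ℝ) (C : Set (BoolConcept X))
    {r : ℕ} (H : Fin r → Finset (BoolConcept X)) (P : PMF (Fin r)) : Prop :=
  ∀ c ∈ C, ∀ (μ : Measure X) [IsProbabilityMeasure μ],
    ENNReal.ofReal (1 - β) ≤ P.toOuterMeasure {i | ∃ h ∈ H i, genError μ c h ≤ α}

/-- The size `max_i ln |H_i|` of a family of finite hypothesis classes. -/
noncomputable def familySize {X : Type*} [MeasurableSpace X] {r : ℕ}
    (H : Fin r → Finset (BoolConcept X)) : ℝ≥0∞ :=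
  ⨆ i, ENNReal.ofReal (Real.log (H i).card)

/-- The representation dimension: the least size of a family that has a distribution on its
indices making it a `(1/4, 1/4)`-probabilistic representation of `C` (and `⊤` if there is no
such family, which can only occur over an infinite domain). -/
noncomputable def repDim {X : Type*} [MeasurableSpace X] (C : Set (BoolConcept X)) : ℝ≥0∞ :=
  ⨅ (r : ℕ) (H : Fin r → Finset (BoolConcept X)) (P : PMF (Fin r))
    (_ : IsProbRepresentation (1 / 4) (1 / 4) C H P), familySize H

/-! A probabilistic representation gives a private learner whose sample size is of the order of its
size, but all of that sample is labeled. The labels are then saved by letting a small labeled sample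
privately label a larger one.

Generic learner. The representation handles every distribution, hence also every reweighting of the
points, so it can be boosted: draw T classes independently and take majority votes of tuples of
hypotheses. A multiplicative weights argument (`exists_votes`, `exists_boosted_representation`)
brings the mean error of a suitable vote down to (127/128)^T, while the logarithm of the class size
grows only by the factor T. The exponential mechanism on the boosted class learns from O(RepDim)
labeled points, even if their labels come from a concept of the class that is only close to the
target (`isAccurateAt_expMechanism`).

Relabeling. Given t labeled points and 8t unlabeled ones, choose a labeling of all 9t points among
those realized by the class, with weight exp(-number of disagreements with the given labels), and
pass the 8t newly labeled points to the next mechanism. The candidate set depends on the data, but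
changing one point changes it only through an at most two-to-one correspondence (`sum_trace_le`).
The original labeled points influence only this choice, so their privacy factor is (2e)^2 whatever
the next mechanism is; an unlabeled point loses a factor 4 only in the round in which it is labeled.
The privacy loss therefore does not grow with the number of rounds (`isPrivateMechanism_relabel`).
Symmetrization and the Sauer-Shelah bound show that the new labels are nearly as accurate as the old
ones (`isAccurateAt_relabel`). Along sample sizes 8^j τ d, with d the VC dimension, the tolerances
η/2^j and the failure probabilities δ/2^j have bounded sums, so O(d) true labels suffice
(`exists_relabeling_mechanism`).

Choosing one random point from each block of constant size turns the constant privacy loss into ε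
(`isPrivateMechanism_subsample`). All this takes place on a finite domain. A general space reduces
to it: points that no hypothesis of the finite representation separates are not separated by the
concepts either (`IsProbRepresentation.apply_eq`), so the finite quotient by the hypotheses carries
the whole problem. -/

/-! ### Finite probability spaces -/

/-- `w` is a probability mass function on the finite type `Y`. -/
structure IsMass {Y : Type*} [Fintype Y] (w : Y → ℝ) : Prop where
  nonneg : ∀ y, 0 ≤ w y
  sum_eq_one : ∑ y, w y = 1

/-- The mean of `g` over i.i.d. points with law `w`. -/
def iidMean {ι Y : Type*} [Fintype ι] [DecidableEq ι] [Fintype Y] (w : Y → ℝ)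
    (g : (ι → Y) → ℝ) : ℝ :=
  ∑ x : ι → Y, (∏ i, w (x i)) * g x

namespace iidMean

variable {ι κ Y S : Type*} [Fintype ι] [DecidableEq ι] [Fintype κ] [DecidableEq κ] [Fintype Y]
  {w : Y → ℝ}

theorem mono (hw : IsMass w) {f g : (ι → Y) → ℝ} (h : ∀ x, f x ≤ g x) :
    iidMean w f ≤ iidMean w g :=
  Finset.sum_le_sum fun x _ => mul_le_mul_of_nonneg_left (h x) (Finset.prod_nonneg fun _ _ => hw.nonneg _)

theorem nonneg (hw : IsMass w) {f : (ι → Y) → ℝ} (h : ∀ x, 0 ≤ f x) : 0 ≤ iidMean w f :=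
  Finset.sum_nonneg fun x _ => mul_nonneg (Finset.prod_nonneg fun _ _ => hw.nonneg _) (h x)

theorem add (f g : (ι → Y) → ℝ) :
    iidMean w (fun x => f x + g x) = iidMean w f + iidMean w g := by
  simp only [iidMean, mul_add, Finset.sum_add_distrib]

theorem const_mul (a : ℝ) (f : (ι → Y) → ℝ) :
    iidMean w (fun x => a * f x) = a * iidMean w f := by
  simp only [iidMean, Finset.mul_sum]
  exact Finset.sum_congr rfl fun x _ => by ring

theorem sum (s : Finset S) (f : S → (ι → Y) → ℝ) :
    iidMean w (fun x => ∑ a ∈ s, f a x) = ∑ a ∈ s, iidMean w (f a) := by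
  simp only [iidMean, Finset.mul_sum]
  exact Finset.sum_comm

theorem prod (g : ι → Y → ℝ) :
    iidMean w (fun x => ∏ i, g i (x i)) = ∏ i, ∑ y, w y * g i y := by
  rw [Finset.prod_univ_sum, Fintype.piFinset_univ]
  simp only [iidMean, Finset.prod_mul_distrib]

theorem const (hw : IsMass w) (a : ℝ) : iidMean w (fun _ : ι → Y => a) = a := by
  have h := prod (w := w) (fun (_ : ι) (_ : Y) => (1 : ℝ))
  simp only [Finset.prod_const_one, mul_one, hw.sum_eq_one] at h
  have h2 := const_mul (w := w) a (fun _ : ι → Y => (1 : ℝ))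
  simpa [h] using h2

theorem comp_equiv (e : ι ≃ κ) (g : (ι → Y) → ℝ) :
    iidMean w (fun x : κ → Y => g (x ∘ e)) = iidMean w g := by
  refine Fintype.sum_equiv (e.arrowCongr (Equiv.refl Y)).symm _ _ fun x => ?_
  have h : (e.arrowCongr (Equiv.refl Y)).symm x = x ∘ e := by
    ext i; simp [Equiv.arrowCongr]
  rw [h, ← e.prod_comp]
  rfl

theorem sumElim (g : (ι ⊕ κ → Y) → ℝ) :
    iidMean w g = iidMean w fun x : ι → Y => iidMean w fun v : κ → Y => g (Sum.elim x v) := by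
  simp only [iidMean, Finset.mul_sum]
  rw [← Fintype.sum_prod_type']
  refine Fintype.sum_equiv (Equiv.sumArrowEquivProdArrow ι κ Y) _ _ fun x => ?_
  have h : Sum.elim (x ∘ Sum.inl) (x ∘ Sum.inr) = x := Sum.elim_comp_inl_inr x
  simp only [Equiv.sumArrowEquivProdArrow, Equiv.coe_fn_mk, Fintype.prod_sum_type]
  rw [← mul_assoc]
  congr 2
  exact h.symm

theorem marginal (hw : IsMass w) {φ : ι → κ} (hφ : Function.Injective φ) (g : (ι → Y) → ℝ) :
    iidMean w (fun x : κ → Y => g (x ∘ φ)) = iidMean w g := by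
  classical
  let e : ι ⊕ {k // k ∉ Set.range φ} ≃ κ :=
    ((Equiv.ofInjective φ hφ).sumCongr (Equiv.refl _)).trans (Equiv.Set.sumCompl (Set.range φ))
  have he : ∀ i, e (Sum.inl i) = φ i := fun i => rfl
  have h := comp_equiv (w := w) e (fun x : ι ⊕ {k // k ∉ Set.range φ} → Y => g (x ∘ Sum.inl))
  have h1 : (fun x : κ → Y => g (x ∘ φ)) = fun x : κ → Y => g ((x ∘ e) ∘ Sum.inl) := by
    rfl
  rw [h1, h, sumElim]
  congr 1; ext x
  simp [const hw]

theorem eval (hw : IsMass w) (i : ι) (f : Y → ℝ) :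
    iidMean w (fun x : ι → Y => f (x i)) = ∑ y, w y * f y := by
  have h := marginal hw (φ := fun _ : Unit => i) (fun _ _ _ => rfl) (fun x => f (x ()))
  have h2 := prod (w := w) (fun (_ : Unit) => f)
  simp only [Finset.univ_unique, Finset.prod_singleton] at h2
  exact h.trans h2

end iidMean

/-- The error of the hypothesis `f` with respect to the target `c` and the weights `w`. -/
def massError {Y : Type*} [Fintype Y] (w : Y → ℝ) (f c : Y → Bool) : ℝ :=
  ∑ y, w y * if f y ≠ c y then 1 else 0

theorem massError_nonneg {Y : Type*} [Fintype Y] {w : Y → ℝ} (hw : IsMass w) (f c : Y → Bool) :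
    0 ≤ massError w f c :=
  Finset.sum_nonneg fun y _ => mul_nonneg (hw.nonneg y) (by split_ifs <;> simp)

theorem hammingDist_eq_sum {ι : Type*} [Fintype ι] (y z : ι → Bool) :
    (hammingDist y z : ℝ) = ∑ i, if y i ≠ z i then (1 : ℝ) else 0 := by
  rw [hammingDist, Finset.sum_boole]

theorem iidMean_hammingDist {ι Y : Type*} [Fintype ι] [DecidableEq ι] [Fintype Y] {w : Y → ℝ}
    (hw : IsMass w) (f c : Y → Bool) :
    iidMean w (fun x : ι → Y => (hammingDist (f ∘ x) (c ∘ x) : ℝ)) =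
      Fintype.card ι * massError w f c := by
  simp only [hammingDist_eq_sum]
  rw [iidMean.sum]
  simp only [Function.comp_apply]
  have : ∀ i : ι, iidMean w (fun x : ι → Y => if f (x i) ≠ c (x i) then (1 : ℝ) else 0) =
      massError w f c := fun i => iidMean.eval hw i (fun y => if f y ≠ c y then (1 : ℝ) else 0)
  simp only [this, Finset.sum_const, Finset.card_univ, nsmul_eq_mul]

theorem one_sub_exp_neg_one : (5 / 8 : ℝ) ≤ 1 - Real.exp (-1) := by
  have h := Real.exp_one_gt_d9
  rw [Real.exp_neg]
  have : (Real.exp 1)⁻¹ ≤ (8 / 3 : ℝ)⁻¹ := inv_anti₀ (by norm_num) (by linarith)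
  linarith [this, (by norm_num : (8 / 3 : ℝ)⁻¹ = 3 / 8)]

/-- The exponential factors over the independent points, and each factor has mean 1 - (1 - 1/e) ·
error, with 1 - 1/e ≥ 5/8. -/
theorem iidMean_exp_neg_hammingDist_le {ι Y : Type*} [Fintype ι] [DecidableEq ι] [Fintype Y]
    {w : Y → ℝ} (hw : IsMass w) (f c : Y → Bool) :
    iidMean w (fun x : ι → Y => Real.exp (-(hammingDist (f ∘ x) (c ∘ x) : ℝ))) ≤
      Real.exp (-(5 / 8) * massError w f c * Fintype.card ι) := by
  have h1 : (fun x : ι → Y => Real.exp (-(hammingDist (f ∘ x) (c ∘ x) : ℝ))) =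
      fun x => ∏ i, (fun y => 1 - (1 - Real.exp (-1)) * if f y ≠ c y then 1 else 0) (x i) := by
    ext x
    rw [hammingDist_eq_sum, ← Finset.sum_neg_distrib, Real.exp_sum]
    refine Finset.prod_congr rfl fun i _ => ?_
    by_cases h : f (x i) = c (x i) <;> simp [h]
  have h2 : ∑ y, w y * (1 - (1 - Real.exp (-1)) * if f y ≠ c y then 1 else 0) =
      1 - (1 - Real.exp (-1)) * massError w f c := by
    simp only [mul_sub, Finset.sum_sub_distrib, mul_one, hw.sum_eq_one, massError, Finset.mul_sum]
    congr 1
    exact Finset.sum_congr rfl fun _ _ => by ring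
  rw [h1, iidMean.prod (fun _ => fun y => 1 - (1 - Real.exp (-1)) * if f y ≠ c y then 1 else 0), h2,
    Finset.prod_const, Finset.card_univ, mul_comm _ (Fintype.card ι : ℝ), Real.exp_nat_mul]
  refine pow_le_pow_left₀ ?_ ?_ _
  · rw [← h2]
    refine Finset.sum_nonneg fun y _ => mul_nonneg (hw.nonneg y) ?_
    split_ifs
    · simp [Real.exp_nonneg]
    · simp
  · have := Real.add_one_le_exp (-(5 / 8) * massError w f c)
    nlinarith [massError_nonneg hw f c, one_sub_exp_neg_one]

/-! ### Boosting of probabilistic representations -/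

/-- With probability at least `3/4` over `P`, the class `H i` contains a hypothesis whose error
is at most `1/4`, for every target in `C` and all weights on the points. -/
def IsMassRepresentation {Y R : Type*} [Fintype Y] [Fintype R] (C : Set (Y → Bool))
    (H : R → Finset (Y → Bool)) (P : R → ℝ) : Prop :=
  ∀ c ∈ C, ∀ w : Y → ℝ, IsMass w → ∀ G : Finset R,
    (∀ i ∉ G, ∀ h ∈ H i, 1 / 4 < massError w h c) → 3 / 4 ≤ ∑ i ∈ G, P i

/-- The pointwise majority vote (ties are resolved in favor of `true`). -/
def majorityVote {Y : Type*} {T : ℕ} (h : Fin T → Y → Bool) : Y → Bool :=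
  fun y => decide (T ≤ 2 * (Finset.univ.filter fun i => h i y = true).card)

/-- The factor by which the weight of `y` changes when the vote `f` is counted. -/
noncomputable def voteFactor {Y : Type*} (f c : Y → Bool) (y : Y) : ℝ :=
  if f y = c y then 8 / 9 else 9 / 8

theorem voteFactor_pos {Y : Type*} (f c : Y → Bool) (y : Y) : 0 < voteFactor f c y := by
  unfold voteFactor; split_ifs <;> norm_num

/-- A wrong majority means that at least half of the votes are wrong. The two factors are
reciprocal, so every correct vote is cancelled by a wrong one. -/
theorem one_le_prod_voteFactor {Y : Type*} {T : ℕ} {h : Fin T → Y → Bool} {c : Y → Bool} {y : Y}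
    (hy : majorityVote h y ≠ c y) : 1 ≤ ∏ i, voteFactor (h i) c y := by
  have hcard : (Finset.univ.filter fun i => h i y = c y).card ≤
      (Finset.univ.filter fun i => ¬ h i y = c y).card := by
    have hT := Finset.card_filter_add_card_filter_not (s := (Finset.univ : Finset (Fin T)))
      (fun i => h i y = true)
    rw [Finset.card_univ, Fintype.card_fin] at hT
    unfold majorityVote at hy
    cases hc : c y
    · simp only [hc, ne_eq, decide_eq_false_iff_not, not_not] at hy
      simp only [Bool.not_eq_true] at hT
      simp only [Bool.not_eq_false]
      omega
    · simp only [hc, ne_eq, decide_eq_true_eq, not_le] at hy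
      omega
  simp only [voteFactor]
  rw [Finset.prod_ite, Finset.prod_const, Finset.prod_const]
  calc (1 : ℝ) = (8 / 9) ^ (Finset.univ.filter fun i => h i y = c y).card *
        (9 / 8) ^ (Finset.univ.filter fun i => h i y = c y).card := by
          rw [← mul_pow]; norm_num
    _ ≤ _ := mul_le_mul_of_nonneg_left (pow_le_pow_right₀ (by norm_num) hcard) (by positivity)

theorem sum_mul_voteFactor {Y : Type*} [Fintype Y] (w : Y → ℝ) (f c : Y → Bool) :
    ∑ y, w y * voteFactor f c y = 8 / 9 * ∑ y, w y + 17 / 72 * massError w f c := by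
  rw [massError, Finset.mul_sum, Finset.mul_sum, ← Finset.sum_add_distrib]
  refine Finset.sum_congr rfl fun y _ => ?_
  by_cases h : f y = c y
  · simp [voteFactor, h]; ring
  · simp [voteFactor, h]; ring

theorem massError_le_sum {Y : Type*} [Fintype Y] {w : Y → ℝ} (hw : ∀ y, 0 ≤ w y)
    (f c : Y → Bool) : massError w f c ≤ ∑ y, w y :=
  Finset.sum_le_sum fun y _ => mul_le_of_le_one_right (hw y) (by split_ifs <;> norm_num)

/-- One round of boosting: the representation is applied to the normalized current weights, and a
good index shrinks the total weight enough to outweigh the growth at bad ones. -/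
theorem exists_vote {Y R : Type*} [Fintype Y] [Fintype R] {C : Set (Y → Bool)}
    {H : R → Finset (Y → Bool)} {P : R → ℝ} (hP : IsMass P) (hH : ∀ i, (H i).Nonempty)
    (hrep : IsMassRepresentation C H P) {c : Y → Bool} (hc : c ∈ C) {w : Y → ℝ}
    (hw : ∀ y, 0 ≤ w y) :
    ∃ h : R → Y → Bool, (∀ i, h i ∈ H i) ∧
      ∑ i, P i * ∑ y, w y * voteFactor (h i) c y ≤ 127 / 128 * ∑ y, w y := by
  classical
  set W := ∑ y, w y with hW
  have hW0 : 0 ≤ W := Finset.sum_nonneg fun y _ => hw y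
  have hex : ∀ i, ∃ h ∈ H i, (∃ h ∈ H i, massError w h c ≤ 1 / 4 * W) →
      massError w h c ≤ 1 / 4 * W := by
    intro i
    by_cases h : ∃ h ∈ H i, massError w h c ≤ 1 / 4 * W
    · obtain ⟨h, h1, h2⟩ := h
      exact ⟨h, h1, fun _ => h2⟩
    · obtain ⟨f, hf⟩ := hH i
      exact ⟨f, hf, fun h' => absurd h' h⟩
  choose h hmem hgood using hex
  refine ⟨h, hmem, ?_⟩
  set G := Finset.univ.filter fun i => ∃ h ∈ H i, massError w h c ≤ 1 / 4 * W with hG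
  have hPG : 3 / 4 * W ≤ (∑ i ∈ G, P i) * W := by
    rcases hW0.eq_or_lt with h0 | hpos
    · simp [← h0]
    refine mul_le_mul_of_nonneg_right ?_ hW0
    refine hrep c hc (fun y => w y / W) ⟨fun y => div_nonneg (hw y) hW0, ?_⟩ G fun i hi f hf => ?_
    · rw [← Finset.sum_div, ← hW, div_self hpos.ne']
    · have h1 : massError (fun y => w y / W) f c = massError w f c / W := by
        simp only [massError, Finset.sum_div]
        exact Finset.sum_congr rfl fun _ _ => by ring
      rw [h1, lt_div_iff₀ hpos]
      by_contra h2
      exact hi (Finset.mem_filter.2 ⟨Finset.mem_univ _, f, hf, not_lt.1 h2⟩)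
  -- The new weight is at most 9/8 · W for a bad index and 8/9 · W + 17/72 · W/4 = 91/96 · W for a
  -- good one, a gain of 17/96 · W. As good indices have mass at least 3/4, the mean is at most (9/8
  -- - 3/4 · 17/96) · W = 127/128 · W.
  have hterm : ∀ i, P i * ∑ y, w y * voteFactor (h i) c y ≤
      P i * (9 / 8 * W) - (if i ∈ G then P i else 0) * (17 / 96 * W) := by
    intro i
    rw [sum_mul_voteFactor, ← hW]
    by_cases hi : i ∈ G
    · have h1 := hgood i (Finset.mem_filter.1 hi).2
      rw [if_pos hi]
      nlinarith [mul_le_mul_of_nonneg_left h1 (hP.nonneg i)]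
    · have h1 : massError w (h i) c ≤ W := massError_le_sum hw _ _
      rw [if_neg hi]
      nlinarith [mul_le_mul_of_nonneg_left h1 (hP.nonneg i)]
  refine (Finset.sum_le_sum fun i _ => hterm i).trans ?_
  rw [Finset.sum_sub_distrib, ← Finset.sum_mul, ← Finset.sum_mul, hP.sum_eq_one,
    Finset.sum_ite_mem, Finset.univ_inter]
  nlinarith

/-- The votes are adaptive: each depends on the indices drawn before it, through the weights that
they left. The induction therefore runs over all weights, normalized or not. -/
theorem exists_votes {Y R : Type*} [Fintype Y] [Fintype R] {C : Set (Y → Bool)}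
    {H : R → Finset (Y → Bool)} {P : R → ℝ} (hP : IsMass P) (hH : ∀ i, (H i).Nonempty)
    (hrep : IsMassRepresentation C H P) {c : Y → Bool} (hc : c ∈ C) (T : ℕ) :
    ∀ {w : Y → ℝ}, (∀ y, 0 ≤ w y) →
    ∃ h : (Fin T → R) → Fin T → Y → Bool, (∀ s i, h s i ∈ H (s i)) ∧
      ∑ s : Fin T → R, (∏ i, P (s i)) * ∑ y, w y * ∏ i, voteFactor (h s i) c y ≤
        (127 / 128) ^ T * ∑ y, w y := by
  induction T with
  | zero =>
    intro w _
    exact ⟨fun _ i => i.elim0, fun _ i => i.elim0, by simp⟩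
  | succ T ih =>
    intro w hw
    obtain ⟨h₀, hmem₀, hsum₀⟩ := exists_vote hP hH hrep hc hw
    have hih := fun i => ih (w := fun y => w y * voteFactor (h₀ i) c y)
      fun y => mul_nonneg (hw y) (voteFactor_pos _ _ _).le
    choose h₁ hmem₁ hsum₁ using hih
    refine ⟨fun s => Fin.cons (h₀ (s 0)) (h₁ (s 0) (Fin.tail s)), fun s i => ?_, ?_⟩
    · refine Fin.cases ?_ (fun j => ?_) i
      · simpa using hmem₀ (s 0)
      · simpa [Fin.tail] using hmem₁ (s 0) (Fin.tail s) j
    · have key := Fintype.sum_equiv (Fin.consEquiv fun _ : Fin (T + 1) => R).symm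
        (fun s : Fin (T + 1) → R => (∏ i, P (s i)) * ∑ y, w y * ∏ i, voteFactor
          ((Fin.cons (h₀ (s 0)) (h₁ (s 0) (Fin.tail s)) : Fin (T + 1) → Y → Bool) i) c y)
        (fun p : R × (Fin T → R) => P p.1 * ((∏ i, P (p.2 i)) *
          ∑ y, w y * voteFactor (h₀ p.1) c y * ∏ i, voteFactor (h₁ p.1 p.2 i) c y))
        (fun s => by
          simp only [Fin.consEquiv, Equiv.coe_fn_symm_mk, Fin.prod_univ_succ, Fin.cons_zero,
            Fin.cons_succ, mul_assoc, Fin.tail])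
      rw [key, Fintype.sum_prod_type]
      simp only [← Finset.mul_sum]
      calc _ ≤ ∑ i, P i * ((127 / 128) ^ T * ∑ y, w y * voteFactor (h₀ i) c y) :=
            Finset.sum_le_sum fun i _ => mul_le_mul_of_nonneg_left (hsum₁ i) (hP.nonneg i)
        _ = (127 / 128) ^ T * ∑ i, P i * ∑ y, w y * voteFactor (h₀ i) c y := by
            rw [Finset.mul_sum]
            exact Finset.sum_congr rfl fun _ _ => by ring
        _ ≤ (127 / 128) ^ T * (127 / 128 * ∑ y, w y) :=
            mul_le_mul_of_nonneg_left hsum₀ (by positivity)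
        _ = _ := by ring

/-- The boosted class of a tuple of indices consists of the majorities of all tuples of hypotheses,
so it contains the adaptively chosen one although it knows neither target nor weights. A point on
which the majority errs keeps at least its initial weight, so the final total weight bounds the
error. -/
theorem exists_boosted_representation {Y R : Type*} [Fintype Y] [DecidableEq Y] [Fintype R]
    {C : Set (Y → Bool)} {H : R → Finset (Y → Bool)} {P : R → ℝ} (hP : IsMass P)
    (hH : ∀ i, (H i).Nonempty) (hrep : IsMassRepresentation C H P) {L : ℝ}
    (hL : ∀ i, ((H i).card : ℝ) ≤ Real.exp L) (T : ℕ) :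
    ∃ (Q : (Fin T → R) → ℝ) (G : (Fin T → R) → Finset (Y → Bool)),
      IsMass Q ∧ (∀ s, (G s).Nonempty) ∧ (∀ s, ((G s).card : ℝ) ≤ Real.exp (T * L)) ∧
      ∀ c ∈ C, ∀ w : Y → ℝ, IsMass w → ∃ f : (Fin T → R) → Y → Bool, (∀ s, f s ∈ G s) ∧
        ∑ s, Q s * massError w (f s) c ≤ (127 / 128) ^ T := by
  classical
  refine ⟨fun s => ∏ i, P (s i), fun s => (Fintype.piFinset fun i => H (s i)).image majorityVote,
    ⟨fun s => Finset.prod_nonneg fun _ _ => hP.nonneg _, ?_⟩, fun s => ?_, fun s => ?_,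
    fun c hc w hw => ?_⟩
  · have := Fintype.sum_pow P T
    rw [← this, hP.sum_eq_one, one_pow]
  · exact (Fintype.piFinset_nonempty.2 fun i => hH _).image _
  · calc (((Fintype.piFinset fun i => H (s i)).image majorityVote).card : ℝ)
        ≤ ((Fintype.piFinset fun i => H (s i)).card : ℝ) := by exact_mod_cast Finset.card_image_le
      _ = ∏ i, ((H (s i)).card : ℝ) := by rw [Fintype.card_piFinset]; push_cast; rfl
      _ ≤ ∏ _i : Fin T, Real.exp L := Finset.prod_le_prod (fun _ _ => by positivity) fun i _ => hL _
      _ = Real.exp (T * L) := by simp [Real.exp_nat_mul]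
  · obtain ⟨h, hmem, hsum⟩ := exists_votes hP hH hrep hc T hw.nonneg
    refine ⟨fun s => majorityVote (h s), fun s => Finset.mem_image_of_mem _
      (Fintype.mem_piFinset.2 (hmem s)), le_trans ?_ (hsum.trans_eq (by rw [hw.sum_eq_one, mul_one]))⟩
    refine Finset.sum_le_sum fun s _ => mul_le_mul_of_nonneg_left ?_
      (Finset.prod_nonneg fun _ _ => hP.nonneg _)
    refine Finset.sum_le_sum fun y _ => mul_le_mul_of_nonneg_left ?_ (hw.nonneg y)
    split_ifs with hy
    · exact one_le_prod_voteFactor hy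
    · exact Finset.prod_nonneg fun _ _ => (voteFactor_pos _ _ _).le

/-! ### Private mechanisms on partially labeled samples -/

/-- A randomized algorithm on labeled points `(x, y)` and unlabeled points `v`, given by its output
probabilities, such that a change of one labeled (unlabeled) point changes these probabilities
at most by the factor `a` (`b`). -/
structure IsPrivateMechanism {ι κ Y O : Type*} [Fintype O] (a b : ℝ)
    (A : (ι → Y) → (ι → Bool) → (κ → Y) → O → ℝ) : Prop where
  nonneg : ∀ x y v o, 0 ≤ A x y v o
  sum_eq_one : ∀ x y v, ∑ o, A x y v o = 1
  labeled : ∀ j x x' y y', (∀ i ≠ j, x i = x' i) → (∀ i ≠ j, y i = y' i) →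
    ∀ v o, A x y v o ≤ a * A x' y' v o
  unlabeled : ∀ j x y v v', (∀ i ≠ j, v i = v' i) → ∀ o, A x y v o ≤ b * A x y v' o

theorem IsPrivateMechanism.mono {ι κ Y O : Type*} [Fintype O] {a b a' b' : ℝ}
    {A : (ι → Y) → (ι → Bool) → (κ → Y) → O → ℝ} (hA : IsPrivateMechanism a b A) (ha : a ≤ a')
    (hb : b ≤ b') : IsPrivateMechanism a' b' A where
  nonneg := hA.nonneg
  sum_eq_one := hA.sum_eq_one
  labeled j x x' y y' hx hy v o := (hA.labeled j x x' y y' hx hy v o).trans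
    (mul_le_mul_of_nonneg_right ha (hA.nonneg _ _ _ _))
  unlabeled j x y v v' hv o := (hA.unlabeled j x y v v' hv o).trans
    (mul_le_mul_of_nonneg_right hb (hA.nonneg _ _ _ _))

theorem hammingDist_le_add_one {ι : Type*} [Fintype ι] {y y' z z' : ι → Bool} {j : ι}
    (hy : ∀ i ≠ j, y i = y' i) (hz : ∀ i ≠ j, z i = z' i) :
    hammingDist y z ≤ hammingDist y' z' + 1 := by
  classical
  unfold hammingDist
  refine (Finset.card_le_card (t := insert j (Finset.univ.filter fun i => y' i ≠ z' i)) ?_).trans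
    (Finset.card_insert_le _ _)
  intro i hi
  by_cases hij : i = j
  · exact Finset.mem_insert.2 (Or.inl hij)
  · refine Finset.mem_insert_of_mem (Finset.mem_filter.2 ⟨Finset.mem_univ _, ?_⟩)
    rw [← hy i hij, ← hz i hij]
    exact (Finset.mem_filter.1 hi).2

theorem exp_neg_hammingDist_le {ι : Type*} [Fintype ι] {y y' z z' : ι → Bool} {j : ι}
    (hy : ∀ i ≠ j, y i = y' i) (hz : ∀ i ≠ j, z i = z' i) :
    Real.exp (-(hammingDist y z : ℝ)) ≤ Real.exp 1 * Real.exp (-(hammingDist y' z' : ℝ)) := by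
  rw [← Real.exp_add, Real.exp_le_exp]
  have h := hammingDist_le_add_one (fun i hi => (hy i hi).symm) fun i hi => (hz i hi).symm
  have h' : (hammingDist y' z' : ℝ) ≤ hammingDist y z + 1 := by exact_mod_cast h
  linarith

theorem div_le_mul_div {N N' D D' p q : ℝ} (hD : 0 < D) (hD' : 0 < D') (hN' : 0 ≤ N')
    (hp : 0 ≤ p) (h : N ≤ p * N') (h' : D' ≤ q * D) : N / D ≤ p * q * (N' / D') := by
  rw [div_le_iff₀ hD, mul_assoc, mul_assoc]
  refine h.trans (mul_le_mul_of_nonneg_left ?_ hp)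
  calc N' = N' / D' * D' := (div_mul_cancel₀ _ hD'.ne').symm
    _ ≤ N' / D' * (q * D) := mul_le_mul_of_nonneg_left h' (by positivity)
    _ = _ := by ring

/-- The exponential mechanism that selects a hypothesis of `G` by its number of errors on the
labeled points. -/
noncomputable def expMechanism {ι Y : Type*} [Fintype ι] [Fintype Y] [DecidableEq Y]
    (G : Finset (Y → Bool)) (x : ι → Y) (y : ι → Bool) (f : Y → Bool) : ℝ :=
  (if f ∈ G then Real.exp (-(hammingDist (f ∘ x) y : ℝ)) else 0) /
    ∑ g ∈ G, Real.exp (-(hammingDist (g ∘ x) y : ℝ))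

section expMechanism

variable {ι κ Y S : Type*} [Fintype ι] [Fintype Y] [DecidableEq Y] [Fintype S]

theorem sum_exp_pos {β : Type*} {G : Finset β} (hG : G.Nonempty) (s : β → ℝ) :
    0 < ∑ g ∈ G, Real.exp (s g) :=
  Finset.sum_pos (fun _ _ => Real.exp_pos _) hG

theorem expMechanism_nonneg (G : Finset (Y → Bool)) (x : ι → Y) (y : ι → Bool) (f : Y → Bool) :
    0 ≤ expMechanism G x y f :=
  div_nonneg (by split_ifs <;> positivity) (Finset.sum_nonneg fun _ _ => (Real.exp_pos _).le)

theorem sum_expMechanism {G : Finset (Y → Bool)} (hG : G.Nonempty) (x : ι → Y) (y : ι → Bool) :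
    ∑ f, expMechanism G x y f = 1 := by
  simp only [expMechanism]
  rw [← Finset.sum_div, Finset.sum_ite_mem, Finset.univ_inter, div_self (sum_exp_pos hG _).ne']

theorem expMechanism_le {G : Finset (Y → Bool)} (hG : G.Nonempty) {j : ι} {x x' : ι → Y}
    {y y' : ι → Bool} (hx : ∀ i ≠ j, x i = x' i) (hy : ∀ i ≠ j, y i = y' i) (f : Y → Bool) :
    expMechanism G x y f ≤ Real.exp 1 * Real.exp 1 * expMechanism G x' y' f := by
  refine div_le_mul_div (sum_exp_pos hG _) (sum_exp_pos hG _) (by split_ifs <;> positivity)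
    (Real.exp_pos 1).le ?_ ?_
  · split_ifs
    · exact exp_neg_hammingDist_le (fun i hi => by simp [hx i hi]) hy
    · simp
  · rw [Finset.mul_sum]
    exact Finset.sum_le_sum fun g _ => exp_neg_hammingDist_le (fun i hi => by simp [hx i hi])
      fun i hi => (hy i hi).symm

/-- The mixture of exponential mechanisms ignores the unlabeled points. -/
theorem isPrivateMechanism_expMechanism {Q : S → ℝ} (hQ : IsMass Q)
    {G : S → Finset (Y → Bool)} (hG : ∀ s, (G s).Nonempty) :
    IsPrivateMechanism (Real.exp 1 * Real.exp 1) 1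
      fun (x : ι → Y) (y : ι → Bool) (_ : κ → Y) f => ∑ s, Q s * expMechanism (G s) x y f where
  nonneg x y _ f := Finset.sum_nonneg fun s _ =>
    mul_nonneg (hQ.nonneg s) (expMechanism_nonneg _ _ _ _)
  sum_eq_one x y _ := by
    rw [Finset.sum_comm]
    simp only [← Finset.mul_sum, sum_expMechanism (hG _), mul_one, hQ.sum_eq_one]
  labeled j x x' y y' hx hy _ f := by
    rw [Finset.mul_sum]
    refine Finset.sum_le_sum fun s _ => ?_
    rw [mul_left_comm]
    exact mul_le_mul_of_nonneg_left (expMechanism_le (hG s) hx hy f) (hQ.nonneg s)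
  unlabeled _ _ _ _ _ _ _ := (one_mul _).ge

end expMechanism

/-! ### Traces of a concept class and the relabeling mechanism -/

/-- The labelings of the points `x` that are realized by `C`. -/
noncomputable def trace {κ Y : Type*} [Fintype κ] [DecidableEq κ] (C : Set (Y → Bool))
    (x : κ → Y) : Finset (κ → Bool) :=
  open Classical in Finset.univ.filter fun z => ∃ c ∈ C, c ∘ x = z

section trace

variable {ι ι' κ τ Y O : Type*} [Fintype τ] [DecidableEq τ] {C : Set (Y → Bool)}

theorem mem_trace {x : τ → Y} {z : τ → Bool} : z ∈ trace C x ↔ ∃ c ∈ C, c ∘ x = z := by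
  simp [trace]

theorem trace_nonempty (hC : C.Nonempty) (x : τ → Y) : (trace C x).Nonempty :=
  let ⟨c, hc⟩ := hC
  ⟨c ∘ x, mem_trace.2 ⟨c, hc, rfl⟩⟩

/-- Evaluating on x' a concept that realizes z on x gives a labeling that agrees with z off j. This
map between the traces is at most two-to-one, since z is determined by its image and its value at j;
hence the factor 2. -/
theorem sum_trace_le {j : τ} {x x' : τ → Y} (hx : ∀ i ≠ j, x i = x' i) {K : ℝ} (hK : 0 ≤ K)
    {f g : (τ → Bool) → ℝ} (hg : ∀ z, 0 ≤ g z)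
    (hfg : ∀ z z', (∀ i ≠ j, z i = z' i) → f z ≤ K * g z') :
    ∑ z ∈ trace C x, f z ≤ 2 * K * ∑ z ∈ trace C x', g z := by
  have hex : ∀ z : τ → Bool, ∃ z' : τ → Bool,
      z ∈ trace C x → z' ∈ trace C x' ∧ ∀ i ≠ j, z i = z' i := by
    intro z
    by_cases hz : z ∈ trace C x
    · obtain ⟨c, hc, rfl⟩ := mem_trace.1 hz
      exact ⟨c ∘ x', fun _ => ⟨mem_trace.2 ⟨c, hc, rfl⟩, fun i hi => by simp [hx i hi]⟩⟩
    · exact ⟨z, fun h => absurd h hz⟩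
  choose b hb using hex
  have hfib : ∀ z' : τ → Bool, ((trace C x).filter fun z => b z = z').card ≤ 2 := by
    intro z'
    refine (Finset.card_le_card_of_injOn (t := Finset.univ) (fun z => z j)
      (fun _ _ => Finset.mem_univ _) ?_).trans_eq (by simp)
    intro z hz w hw hzw
    simp only [Finset.coe_filter, Set.mem_ofPred_eq] at hz hw
    ext i
    by_cases hi : i = j
    · subst hi; exact hzw
    · rw [(hb z hz.1).2 i hi, (hb w hw.1).2 i hi, hz.2, hw.2]
  calc ∑ z ∈ trace C x, f z ≤ ∑ z ∈ trace C x, K * g (b z) :=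
        Finset.sum_le_sum fun z hz => hfg _ _ (hb z hz).2
    _ = ∑ z' ∈ trace C x', ∑ z ∈ (trace C x).filter (fun z => b z = z'), K * g (b z) :=
        (Finset.sum_fiberwise_of_maps_to (fun z hz => (hb z hz).1) _).symm
    _ ≤ ∑ z' ∈ trace C x', 2 * (K * g z') := by
        refine Finset.sum_le_sum fun z' _ => ?_
        rw [Finset.sum_congr rfl fun z hz => by rw [(Finset.mem_filter.1 hz).2], Finset.sum_const,
          nsmul_eq_mul]
        exact mul_le_mul_of_nonneg_right (by exact_mod_cast hfib z') (mul_nonneg hK (hg z'))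
    _ = _ := by rw [Finset.mul_sum]; exact Finset.sum_congr rfl fun _ _ => by ring

variable [Fintype ι] [DecidableEq ι] [Fintype ι'] [DecidableEq ι']

/-- Label the points `w ∘ Sum.inl` by a privately chosen concept that almost agrees with the labels
`y` on `x`, and apply the mechanism `A` to the result. -/
noncomputable def relabel (C : Set (Y → Bool))
    (A : (ι' → Y) → (ι' → Bool) → (κ → Y) → O → ℝ) (x : ι → Y) (y : ι → Bool)
    (w : ι' ⊕ κ → Y) (o : O) : ℝ :=
  (∑ z ∈ trace C (Sum.elim x (w ∘ Sum.inl)), Real.exp (-(hammingDist (z ∘ Sum.inl) y : ℝ)) *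
      A (w ∘ Sum.inl) (z ∘ Sum.inr) (w ∘ Sum.inr) o) /
    ∑ z ∈ trace C (Sum.elim x (w ∘ Sum.inl)), Real.exp (-(hammingDist (z ∘ Sum.inl) y : ℝ))

/-- A labeled point enters only through the choice of the labeling, so numerator and denominator
each change by at most 2e and the constant a does not appear. A newly labeled point changes the
trace (factor 2 above and below) and one labeled input of `A` (factor a). The remaining points are
seen only by `A`. -/
theorem isPrivateMechanism_relabel [Fintype O] (hC : C.Nonempty) {a b b' : ℝ} (ha : 0 ≤ a)
    {A : (ι' → Y) → (ι' → Bool) → (κ → Y) → O → ℝ} (hA : IsPrivateMechanism a b A)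
    (hab : 4 * a ≤ b') (hb : b ≤ b') :
    IsPrivateMechanism (2 * Real.exp 1 * (2 * Real.exp 1)) b'
      (relabel (ι := ι) C A) where
  nonneg x y w o := div_nonneg (Finset.sum_nonneg fun _ _ => mul_nonneg (Real.exp_pos _).le
    (hA.nonneg _ _ _ _)) (Finset.sum_nonneg fun _ _ => (Real.exp_pos _).le)
  sum_eq_one x y w := by
    simp only [relabel]
    rw [← Finset.sum_div, Finset.sum_comm]
    simp only [← Finset.mul_sum, hA.sum_eq_one, mul_one]
    exact div_self (sum_exp_pos (trace_nonempty hC _) _).ne'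
  labeled j x x' y y' hx hy w o := by
    have hx' : ∀ i ≠ Sum.inl j, Sum.elim x (w ∘ Sum.inl) i = Sum.elim x' (w ∘ Sum.inl) i := by
      rintro (i | i) hi
      · exact hx i fun h => hi (h ▸ rfl)
      · rfl
    refine div_le_mul_div (sum_exp_pos (trace_nonempty hC _) _)
      (sum_exp_pos (trace_nonempty hC _) _) (Finset.sum_nonneg fun _ _ =>
        mul_nonneg (Real.exp_pos _).le (hA.nonneg _ _ _ _)) (by positivity) ?_ ?_
    · refine sum_trace_le hx' (Real.exp_pos 1).le (fun z => mul_nonneg (Real.exp_pos _).le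
        (hA.nonneg _ _ _ _)) fun z z' hz => ?_
      have h1 : z ∘ Sum.inr = z' ∘ Sum.inr := funext fun i => hz (Sum.inr i) Sum.inr_ne_inl
      rw [h1, ← mul_assoc]
      exact mul_le_mul_of_nonneg_right (exp_neg_hammingDist_le
        (fun i hi => hz (Sum.inl i) fun h => hi (Sum.inl_injective h)) hy) (hA.nonneg _ _ _ _)
    · refine sum_trace_le (fun i hi => (hx' i hi).symm) (Real.exp_pos 1).le
        (fun z => (Real.exp_pos _).le) fun z z' hz => ?_
      exact exp_neg_hammingDist_le (fun i hi => hz (Sum.inl i) fun h => hi (Sum.inl_injective h))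
        fun i hi => (hy i hi).symm
  unlabeled j x y w w' hw o := by
    have hnum : ∀ w : ι' ⊕ κ → Y, 0 ≤ ∑ z ∈ trace C (Sum.elim x (w ∘ Sum.inl)),
        Real.exp (-(hammingDist (z ∘ Sum.inl) y : ℝ)) *
          A (w ∘ Sum.inl) (z ∘ Sum.inr) (w ∘ Sum.inr) o := fun w =>
      Finset.sum_nonneg fun _ _ => mul_nonneg (Real.exp_pos _).le (hA.nonneg _ _ _ _)
    have hpos : ∀ w : ι' ⊕ κ → Y, 0 < ∑ z ∈ trace C (Sum.elim x (w ∘ Sum.inl)),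
        Real.exp (-(hammingDist (z ∘ Sum.inl) y : ℝ)) := fun w =>
      sum_exp_pos (trace_nonempty hC _) _
    obtain j | j := j
    · have hv : w ∘ Sum.inr = w' ∘ Sum.inr := funext fun i => hw (Sum.inr i) Sum.inr_ne_inl
      have hx' : ∀ i ≠ Sum.inr j,
          Sum.elim x (w ∘ Sum.inl) i = Sum.elim x (w' ∘ Sum.inl) i := by
        rintro (i | i) hi
        · rfl
        · exact hw (Sum.inl i) fun h => hi (congrArg Sum.inr (Sum.inl_injective h))
      refine (div_le_mul_div (p := 2 * a) (q := 2 * 1) (hpos w) (hpos w') (hnum w')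
        (by positivity) (sum_trace_le hx' ha (fun z => mul_nonneg (Real.exp_pos _).le
          (hA.nonneg _ _ _ _)) fun z z' hz => ?_)
        (sum_trace_le (fun i hi => (hx' i hi).symm) zero_le_one
          (fun z => (Real.exp_pos _).le) fun z z' hz => ?_)).trans
        (mul_le_mul_of_nonneg_right (by linarith) (div_nonneg (hnum w') (hpos w').le))
      · have h1 : z ∘ Sum.inl = z' ∘ Sum.inl := funext fun i => hz (Sum.inl i) Sum.inl_ne_inr
        rw [h1, mul_left_comm, hv]
        refine mul_le_mul_of_nonneg_left (hA.labeled j _ _ _ _ (fun i hi => hw (Sum.inl i)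
          fun h => hi (Sum.inl_injective h)) (fun i hi => hz (Sum.inr i)
          fun h => hi (Sum.inr_injective h)) _ _) (Real.exp_pos _).le
      · have h1 : z ∘ Sum.inl = z' ∘ Sum.inl := funext fun i => hz (Sum.inl i) Sum.inl_ne_inr
        rw [h1, one_mul]
    · have hu : w ∘ Sum.inl = w' ∘ Sum.inl := funext fun i => hw (Sum.inl i) Sum.inl_ne_inr
      simp only [relabel]
      rw [mul_div_assoc', hu]
      refine div_le_div_of_nonneg_right ?_ (hpos w').le
      rw [Finset.mul_sum]
      refine Finset.sum_le_sum fun z _ => ?_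
      rw [mul_left_comm]
      refine mul_le_mul_of_nonneg_left ((hA.unlabeled j _ _ _ _ (fun i hi => hw (Sum.inr i)
          fun h => hi (Sum.inr_injective h)) _).trans
          (mul_le_mul_of_nonneg_right hb (hA.nonneg _ _ _ _))) (Real.exp_pos _).le

end trace

/-! ### Symmetrization -/

section symmetrization

variable {ι Y : Type*} [Fintype ι]

/-- The difference of the numbers of errors on the second and on the first points. -/
def errorGap (q : ι × Bool → Bool) : ℝ :=
  ∑ i, ((q (i, true)).toNat - (q (i, false)).toNat : ℝ)

theorem errorGap_eq (c c' : Y → Bool) (X : ι × Bool → Y) :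
    errorGap (fun p => xor (c' (X p)) (c (X p))) =
      (hammingDist (fun i => c' (X (i, true))) (fun i => c (X (i, true))) : ℝ) -
        hammingDist (fun i => c' (X (i, false))) (fun i => c (X (i, false))) := by
  have h : ∀ a b : Bool, ((xor a b).toNat : ℝ) = if a ≠ b then 1 else 0 := by
    intro a b; cases a <;> cases b <;> simp
  simp only [errorGap, hammingDist_eq_sum, Finset.sum_sub_distrib, h]

variable [DecidableEq ι]

/-- Exchange the two points with index `i` whenever `σ i = true`. -/
def swapPairs (σ : ι → Bool) : ι × Bool ≃ ι × Bool :=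
  Function.Involutive.toPerm (fun p => (p.1, xor p.2 (σ p.1))) fun p => by simp

/-- The error patterns on `X` of the concepts in `C` with respect to the target `c`. -/
noncomputable def errorPatterns (C : Set (Y → Bool)) (c : Y → Bool) (X : ι × Bool → Y) :
    Finset (ι × Bool → Bool) :=
  (trace C X).image fun z p => xor (z p) (c (X p))

theorem mem_errorPatterns {C : Set (Y → Bool)} {c : Y → Bool} {X : ι × Bool → Y}
    {q : ι × Bool → Bool} :
    q ∈ errorPatterns C c X ↔ ∃ c' ∈ C, (fun p => xor (c' (X p)) (c (X p))) = q := by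
  simp only [errorPatterns, Finset.mem_image, mem_trace]
  constructor
  · rintro ⟨_, ⟨c', hc', rfl⟩, rfl⟩
    exact ⟨c', hc', rfl⟩
  · rintro ⟨c', hc', rfl⟩
    exact ⟨_, ⟨c', hc', rfl⟩, rfl⟩

theorem errorPatterns_comp (C : Set (Y → Bool)) (c : Y → Bool) (X : ι × Bool → Y)
    (e : ι × Bool ≃ ι × Bool) :
    errorPatterns C c (X ∘ e) = (errorPatterns C c X).image fun q => q ∘ e := by
  ext q
  simp only [Finset.mem_image, mem_errorPatterns]
  constructor
  · rintro ⟨c', hc', rfl⟩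
    exact ⟨_, ⟨c', hc', rfl⟩, rfl⟩
  · rintro ⟨_, ⟨c', hc', rfl⟩, rfl⟩
    exact ⟨c', hc', rfl⟩

/-- Under random swaps the gap is a sum of independent terms ±a with |a| ≤ 1, and cosh(ηa) ≤
exp(η²/2) for each of them. -/
theorem sum_exp_errorGap_le (η : ℝ) (q : ι × Bool → Bool) :
    ∑ σ : ι → Bool, Real.exp (η * errorGap (q ∘ swapPairs σ)) ≤
      2 ^ Fintype.card ι * Real.exp (η ^ 2 / 2 * Fintype.card ι) := by
  have h1 : ∀ σ : ι → Bool, Real.exp (η * errorGap (q ∘ swapPairs σ)) =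
      ∏ i, Real.exp (η * ((q (i, xor true (σ i))).toNat - (q (i, xor false (σ i))).toNat)) := by
    intro σ
    rw [errorGap, Finset.mul_sum, Real.exp_sum]
    rfl
  simp only [h1]
  have h2 := Finset.prod_univ_sum (fun _ : ι => (Finset.univ : Finset Bool)) fun i s =>
    Real.exp (η * ((q (i, xor true s)).toNat - (q (i, xor false s)).toNat))
  rw [Fintype.piFinset_univ] at h2
  rw [← h2, mul_comm (η ^ 2 / 2), Real.exp_nat_mul, ← mul_pow, ← Finset.card_univ,
    ← Finset.prod_const]
  refine Finset.prod_le_prod (fun _ _ => Finset.sum_nonneg fun _ _ => (Real.exp_pos _).le)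
    fun i _ => ?_
  have hc : ∀ a : ℝ, a ^ 2 ≤ 1 →
      Real.exp (η * -a) + Real.exp (η * a) ≤ 2 * Real.exp (η ^ 2 / 2) := by
    intro a ha
    have h := Real.cosh_le_exp_half_sq (η * a)
    rw [Real.cosh_eq] at h
    have h' : Real.exp ((η * a) ^ 2 / 2) ≤ Real.exp (η ^ 2 / 2) := by
      rw [Real.exp_le_exp]; nlinarith [sq_nonneg η]
    rw [mul_neg]
    linarith
  have h3 := hc ((q (i, true)).toNat - (q (i, false)).toNat) (by
    cases q (i, true) <;> cases q (i, false) <;> norm_num)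
  simpa [Fintype.sum_bool] using h3

variable [Fintype Y]

/-- The number of errors of the concepts in `C` on a second sample exceeds the one on a first
sample of the same size only with small probability, uniformly over `C`. -/
theorem iidMean_errorGap_le {w : Y → ℝ} (hw : IsMass w) {C : Set (Y → Bool)} (c : Y → Bool)
    {B η : ℝ} (hB : ∀ X : ι × Bool → Y, ((trace C X).card : ℝ) ≤ B) (hη : 0 ≤ η) :
    (iidMean w fun X : ι × Bool → Y => open Classical in
      if ∃ c' ∈ C, (hammingDist (fun i => c' (X (i, false))) (fun i => c (X (i, false))) : ℝ) +
        η * Fintype.card ι < hammingDist (fun i => c' (X (i, true))) (fun i => c (X (i, true)))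
      then (1 : ℝ) else 0) ≤ B * Real.exp (-(η ^ 2 / 2 * Fintype.card ι)) := by
  set t : ℝ := (Fintype.card ι : ℝ) with ht
  set F : (ι × Bool → Y) → ℝ := fun X =>
    ∑ q ∈ errorPatterns C c X, Real.exp (η * errorGap q) with hF
  -- Exponential Markov bound: a violating concept contributes exp(η · gap) > exp(η² t) to the sum
  -- over the error patterns.
  have hind : ∀ X : ι × Bool → Y, (open Classical in
      if ∃ c' ∈ C, (hammingDist (fun i => c' (X (i, false))) (fun i => c (X (i, false))) : ℝ) +
        η * t < hammingDist (fun i => c' (X (i, true))) (fun i => c (X (i, true)))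
      then (1 : ℝ) else 0) ≤ Real.exp (-(η ^ 2 * t)) * F X := by
    intro X
    split_ifs with h
    · obtain ⟨c', hc', h⟩ := h
      have h1 : Real.exp (η * errorGap fun p => xor (c' (X p)) (c (X p))) ≤ F X :=
        Finset.single_le_sum (f := fun q => Real.exp (η * errorGap q))
          (fun _ _ => (Real.exp_pos _).le) (mem_errorPatterns.2 ⟨c', hc', rfl⟩)
      refine le_trans ?_ (mul_le_mul_of_nonneg_left h1 (Real.exp_pos _).le)
      rw [← Real.exp_add, Real.one_le_exp_iff, errorGap_eq]
      nlinarith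
    · exact mul_nonneg (Real.exp_pos _).le (Finset.sum_nonneg fun _ _ => (Real.exp_pos _).le)
  -- Swaps preserve the law of the double sample, so the mean can be averaged over all σ. For a
  -- fixed double sample only at most B patterns remain, each with a random sign sum.
  have hswap : ∀ σ : ι → Bool, (iidMean w fun X => ∑ q ∈ errorPatterns C c X,
      Real.exp (η * errorGap (q ∘ swapPairs σ))) = iidMean w F := by
    intro σ
    rw [← iidMean.comp_equiv (swapPairs σ) F]
    congr 1
    ext X
    rw [hF]
    simp only
    rw [errorPatterns_comp, Finset.sum_image]
    exact fun q _ q' _ h => (swapPairs σ).surjective.injective_comp_right h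
  have hF_le : 2 ^ Fintype.card ι * iidMean w F ≤
      2 ^ Fintype.card ι * (B * Real.exp (η ^ 2 / 2 * t)) := by
    calc 2 ^ Fintype.card ι * iidMean w F
        = ∑ σ : ι → Bool, iidMean w fun X => ∑ q ∈ errorPatterns C c X,
            Real.exp (η * errorGap (q ∘ swapPairs σ)) := by
          simp [hswap]
      _ = iidMean w fun X => ∑ q ∈ errorPatterns C c X, ∑ σ : ι → Bool,
            Real.exp (η * errorGap (q ∘ swapPairs σ)) := by
          rw [← iidMean.sum]
          congr 1
          ext X
          exact Finset.sum_comm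
      _ ≤ iidMean w fun _ : ι × Bool → Y => B * (2 ^ Fintype.card ι *
            Real.exp (η ^ 2 / 2 * t)) := by
          refine iidMean.mono hw fun X => ?_
          refine (Finset.sum_le_sum fun q _ => sum_exp_errorGap_le η q).trans ?_
          rw [Finset.sum_const, nsmul_eq_mul]
          refine mul_le_mul_of_nonneg_right (le_trans ?_ (hB X)) (by positivity)
          exact_mod_cast Finset.card_image_le
      _ = _ := by rw [iidMean.const hw]; ring
  have hF_le' := le_of_mul_le_mul_left hF_le (by positivity)
  calc _ ≤ _ := iidMean.mono hw hind
    _ = Real.exp (-(η ^ 2 * t)) * iidMean w F := iidMean.const_mul _ _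
    _ ≤ Real.exp (-(η ^ 2 * t)) * (B * Real.exp (η ^ 2 / 2 * t)) :=
        mul_le_mul_of_nonneg_left hF_le' (Real.exp_pos _).le
    _ = _ := by
        rw [mul_left_comm, ← Real.exp_add]
        congr 2
        ring

end symmetrization

/-! ### Accuracy of the relabeling mechanism and of the exponential mechanism -/

/-- If the labels come from a concept of `C` that has at most a `θ`-fraction of errors on the labeled
points with respect to the target `c`, then the mean of `b` over the output of `A` is at most
`β` on average over the sample. -/
def IsAccurateAt {ι κ Y O : Type*} [Fintype ι] [DecidableEq ι] [Fintype κ] [DecidableEq κ]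
    [Fintype Y] [Fintype O] (C : Set (Y → Bool)) (c : Y → Bool) (w : Y → ℝ) (b : O → ℝ)
    (θ β : ℝ) (A : (ι → Y) → (ι → Bool) → (κ → Y) → O → ℝ) : Prop :=
  ∃ g : (ι → Y) → ℝ, (∀ x, 0 ≤ g x) ∧ iidMean w g ≤ β ∧
    ∀ x, ∀ c' ∈ C, (hammingDist (c' ∘ x) (c ∘ x) : ℝ) ≤ θ * Fintype.card ι →
      (iidMean w fun v => ∑ o, A x (c' ∘ x) v o * b o) ≤ g x

/-- The given labeling itself has weight 1, so the at most B labelings with more than ηt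
disagreements receive total probability at most B·exp(-ηt). Any other one has at most (θ - η)t
errors on the labeled points. Unless one of the 8 blocks of new points is exceptional for
symmetrization, it has at most θt errors on each block, which is the tolerance of `A`. -/
theorem isAccurateAt_relabel {ι κ Y O : Type*} [Fintype ι] [DecidableEq ι] [Fintype κ]
    [DecidableEq κ] [Fintype Y] [Fintype O] {C : Set (Y → Bool)} {c : Y → Bool} {w : Y → ℝ}
    (hw : IsMass w) {b : O → ℝ} (hb1 : ∀ o, b o ≤ 1) {θ β p q : ℝ}
    {A : (ι × Fin 8 → Y) → (ι × Fin 8 → Bool) → (κ → Y) → O → ℝ} (hA : IsPrivateMechanism p q A)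
    (hacc : IsAccurateAt C c w b θ β A) {B η : ℝ} (hη : 0 ≤ η)
    (hB : ∀ X : ι ⊕ ι × Fin 8 → Y, ((trace C X).card : ℝ) ≤ B)
    (hB2 : ∀ X : ι × Bool → Y, ((trace C X).card : ℝ) ≤ B) :
    IsAccurateAt C c w b (θ - 2 * η) (β + B * Real.exp (-(η * Fintype.card ι)) +
      8 * (B * Real.exp (-(η ^ 2 / 2 * Fintype.card ι)))) (relabel (ι := ι) C A) := by
  classical
  obtain ⟨g, hg0, hgβ, hg⟩ := hacc
  set t : ℝ := (Fintype.card ι : ℝ) with ht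
  have hB0 : 0 ≤ B := by
    obtain ⟨y, -⟩ : ∃ y, w y ≠ 0 := by
      by_contra! h
      have := hw.sum_eq_one
      simp [h] at this
    exact (Nat.cast_nonneg _).trans (hB2 fun _ => y)
  set bad : Fin 8 → (ι → Y) → (ι × Fin 8 → Y) → ℝ := fun l x u =>
    if ∃ c' ∈ C, (hammingDist (fun i => c' (x i)) (fun i => c (x i)) : ℝ) + η * t <
      hammingDist (fun i => c' (u (i, l))) (fun i => c (u (i, l))) then 1 else 0 with hbad
  have hbad0 : ∀ l x u, 0 ≤ bad l x u := fun l x u => by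
    simp only [hbad]; split_ifs <;> norm_num
  have hbadle : ∀ l, (iidMean w fun x => iidMean w fun u => bad l x u) ≤
      B * Real.exp (-(η ^ 2 / 2 * t)) := by
    intro l
    refine le_trans (le_of_eq ?_) (iidMean_errorGap_le hw c hB2 hη)
    -- The labeled sample and block l together form a double sample, the form in which
    -- symmetrization applies.
    have hψ : Function.Injective fun p : ι × Bool =>
        (if p.2 then Sum.inr (p.1, l) else Sum.inl p.1 : ι ⊕ ι × Fin 8) := by
      rintro ⟨i, _ | _⟩ ⟨j, _ | _⟩ h <;> simp_all
    rw [← iidMean.marginal hw hψ, iidMean.sumElim]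
    rfl
  refine ⟨fun x => B * Real.exp (-(η * t)) + ∑ l, iidMean w (bad l x) + iidMean w g,
    fun x => ?_, ?_, ?_⟩
  · have h1 : 0 ≤ ∑ l, iidMean w (bad l x) :=
      Finset.sum_nonneg fun l _ => iidMean.nonneg hw (hbad0 l x)
    exact add_nonneg (add_nonneg (mul_nonneg hB0 (Real.exp_pos _).le) h1) (iidMean.nonneg hw hg0)
  · rw [iidMean.add, iidMean.add, iidMean.const hw, iidMean.const hw, iidMean.sum]
    have h1 : ∑ l, (iidMean w fun x => iidMean w (bad l x)) ≤
        ∑ _l : Fin 8, B * Real.exp (-(η ^ 2 / 2 * t)) := Finset.sum_le_sum fun l _ => hbadle l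
    rw [Finset.sum_const, Finset.card_univ, Fintype.card_fin, nsmul_eq_mul] at h1
    push_cast at h1
    linarith
  · intro x c₀ hc₀ hdist
    rw [iidMean.sumElim]
    have hR : B * Real.exp (-(η * t)) + ∑ l, iidMean w (bad l x) + iidMean w g =
        iidMean w fun u : ι × Fin 8 → Y => B * Real.exp (-(η * t)) + ∑ l, bad l x u + g u := by
      rw [iidMean.add, iidMean.add, iidMean.const hw, iidMean.sum]
    refine le_trans (iidMean.mono hw fun u => ?_) hR.ge
    set Z := trace C (Sum.elim x u) with hZ
    set e : (ι ⊕ ι × Fin 8 → Bool) → ℝ := fun z =>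
      Real.exp (-(hammingDist (z ∘ Sum.inl) (c₀ ∘ x) : ℝ)) with he
    set φ : (ι ⊕ ι × Fin 8 → Bool) → ℝ := fun z =>
      iidMean w fun v => ∑ o, A u (z ∘ Sum.inr) v o * b o with hφ
    have hφ1 : ∀ z, φ z ≤ 1 := by
      intro z
      refine (iidMean.mono hw fun v => ?_).trans_eq (iidMean.const hw 1)
      rw [← hA.sum_eq_one u (z ∘ Sum.inr) v]
      exact Finset.sum_le_sum fun o _ => mul_le_of_le_one_right (hA.nonneg _ _ _ _) (hb1 o)
    have hD : 1 ≤ ∑ z ∈ Z, e z := by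
      have hmem : c₀ ∘ Sum.elim x u ∈ Z := mem_trace.2 ⟨c₀, hc₀, rfl⟩
      refine le_trans (le_of_eq ?_) (Finset.single_le_sum (f := e)
        (fun _ _ => (Real.exp_pos _).le) hmem)
      have : (c₀ ∘ Sum.elim x u) ∘ Sum.inl = c₀ ∘ x := rfl
      simp [he, this]
    have heq : (iidMean w fun v => ∑ o, relabel C A x (c₀ ∘ x) (Sum.elim u v) o * b o) =
        (∑ z ∈ Z, e z * φ z) / ∑ z ∈ Z, e z := by
      have h1 : ∀ v : κ → Y, ∑ o, relabel C A x (c₀ ∘ x) (Sum.elim u v) o * b o =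
          (∑ z ∈ Z, e z)⁻¹ * ∑ z ∈ Z, e z * ∑ o, A u (z ∘ Sum.inr) v o * b o := by
        intro v
        simp only [relabel, Sum.elim_comp_inl, Sum.elim_comp_inr, Finset.mul_sum, Finset.sum_mul,
          Finset.sum_div]
        rw [Finset.sum_comm]
        refine Finset.sum_congr rfl fun z _ => Finset.sum_congr rfl fun o _ => ?_
        rw [div_eq_mul_inv]
        ring
      simp only [h1]
      rw [iidMean.const_mul, iidMean.sum, div_eq_inv_mul]
      congr 1
      exact Finset.sum_congr rfl fun z _ => iidMean.const_mul _ _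
    have hsum0 : 0 ≤ ∑ l, bad l x u := Finset.sum_nonneg fun l _ => hbad0 l x u
    have hterm : ∀ z ∈ Z, e z * φ z ≤ Real.exp (-(η * t)) + e z * (∑ l, bad l x u + g u) := by
      intro z hz
      have he0 : 0 < e z := Real.exp_pos _
      by_cases h1 : η * t < hammingDist (z ∘ Sum.inl) (c₀ ∘ x)
      · have h2 : e z ≤ Real.exp (-(η * t)) := Real.exp_le_exp.2 (by linarith)
        have h3 : 0 ≤ e z * (∑ l, bad l x u + g u) :=
          mul_nonneg he0.le (add_nonneg hsum0 (hg0 u))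
        nlinarith [mul_le_of_le_one_right he0.le (hφ1 z)]
      · refine le_add_of_nonneg_of_le (Real.exp_pos _).le (mul_le_mul_of_nonneg_left ?_ he0.le)
        by_cases h2 : ∃ l, bad l x u = 1
        · obtain ⟨l, hl⟩ := h2
          have h3 := Finset.single_le_sum (f := fun l => bad l x u)
            (fun l _ => hbad0 l x u) (Finset.mem_univ l)
          simp only [hl] at h3
          linarith [hφ1 z, hg0 u]
        · obtain ⟨c', hc', rfl⟩ := mem_trace.1 hz
          refine le_add_of_nonneg_of_le hsum0 (hg u c' hc' ?_)
          have hx : (hammingDist (c' ∘ x) (c ∘ x) : ℝ) ≤ (θ - η) * t := by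
            have h3 := hammingDist_triangle (c' ∘ x) (c₀ ∘ x) (c ∘ x)
            have h4 : (hammingDist (c' ∘ x) (c ∘ x) : ℝ) ≤
              hammingDist (c' ∘ x) (c₀ ∘ x) + hammingDist (c₀ ∘ x) (c ∘ x) := by exact_mod_cast h3
            have h5 : (hammingDist (c' ∘ x) (c₀ ∘ x) : ℝ) ≤ η * t := not_lt.1 h1
            linarith
          have hu : ∀ l : Fin 8, (hammingDist (fun i => c' (u (i, l))) fun i => c (u (i, l)) : ℝ) ≤
              θ * t := by
            intro l
            by_contra! h3
            refine h2 ⟨l, if_pos ⟨c', hc', lt_of_le_of_lt ?_ h3⟩⟩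
            have h4 : (hammingDist (fun i => c' (x i)) fun i => c (x i) : ℝ) ≤ (θ - η) * t := hx
            linarith
          have hsplit : (hammingDist (c' ∘ u) (c ∘ u) : ℝ) =
              ∑ l : Fin 8, (hammingDist (fun i => c' (u (i, l))) fun i => c (u (i, l)) : ℝ) := by
            simp only [hammingDist_eq_sum]
            rw [Fintype.sum_prod_type, Finset.sum_comm]
            rfl
          rw [hsplit]
          refine (Finset.sum_le_sum fun l _ => hu l).trans_eq ?_
          rw [Finset.sum_const, Finset.card_univ, nsmul_eq_mul, Fintype.card_prod, ht]
          push_cast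
          ring
    rw [heq, div_le_iff₀ (by linarith)]
    calc ∑ z ∈ Z, e z * φ z
        ≤ ∑ z ∈ Z, (Real.exp (-(η * t)) + e z * (∑ l, bad l x u + g u)) :=
          Finset.sum_le_sum hterm
      _ = (Z.card : ℝ) * Real.exp (-(η * t)) + (∑ z ∈ Z, e z) * (∑ l, bad l x u + g u) := by
          rw [Finset.sum_add_distrib, Finset.sum_const, nsmul_eq_mul, Finset.sum_mul]
      _ ≤ B * Real.exp (-(η * t)) * (∑ z ∈ Z, e z) +
            (∑ z ∈ Z, e z) * (∑ l, bad l x u + g u) := by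
          refine add_le_add_left ?_ _
          calc (Z.card : ℝ) * Real.exp (-(η * t)) ≤ B * Real.exp (-(η * t)) :=
                mul_le_mul_of_nonneg_right (hB _) (Real.exp_pos _).le
            _ ≤ _ := le_mul_of_one_le_right (by positivity) hD
      _ = _ := by ring

/-- The good hypothesis `f s` bounds the normalization from below, and the expected weight of the
bad hypotheses is tiny. The exponents combine to α/6 + α/3 - 5α/8 = -α/8: label noise,
normalization, and expected weight of a bad hypothesis. -/
theorem isAccurateAt_expMechanism {ι κ Y S : Type*} [Fintype ι] [DecidableEq ι] [Nonempty ι]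
    [Fintype κ] [DecidableEq κ] [Fintype Y] [DecidableEq Y] [Fintype S] {C : Set (Y → Bool)}
    {c : Y → Bool} {w : Y → ℝ} (hw : IsMass w) {Q : S → ℝ} (hQ : IsMass Q)
    {G : S → Finset (Y → Bool)} (hG : ∀ s, (G s).Nonempty) {M : ℝ}
    (hM : ∀ s, ((G s).card : ℝ) ≤ Real.exp M) {ρ : ℝ} {f : S → Y → Bool} (hf : ∀ s, f s ∈ G s)
    (hρ : ∑ s, Q s * massError w (f s) c ≤ ρ) {α : ℝ} (hα : 0 < α) :
    IsAccurateAt C c w (fun h => if α < massError w h c then (1 : ℝ) else 0) (α / 6)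
      (6 * ρ / α + Real.exp (M - α / 8 * Fintype.card ι))
      fun (x : ι → Y) (y : ι → Bool) (_ : κ → Y) h => ∑ s, Q s * expMechanism (G s) x y h := by
  set t : ℝ := (Fintype.card ι : ℝ) with ht
  have ht0 : 0 < t := Nat.cast_pos.2 Fintype.card_pos
  set Bad : S → Finset (Y → Bool) := fun s => (G s).filter fun h => α < massError w h c with hBad
  refine ⟨fun x => ∑ s, Q s * (6 / (α * t) * hammingDist (f s ∘ x) (c ∘ x) +
    Real.exp (α / 2 * t) * ∑ h ∈ Bad s, Real.exp (-(hammingDist (h ∘ x) (c ∘ x) : ℝ))),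
    fun x => ?_, ?_, ?_⟩
  · exact Finset.sum_nonneg fun s _ => mul_nonneg (hQ.nonneg s) (by positivity)
  · have hs : ∀ s, (iidMean w fun x : ι → Y => Q s * (6 / (α * t) *
        hammingDist (f s ∘ x) (c ∘ x) + Real.exp (α / 2 * t) *
          ∑ h ∈ Bad s, Real.exp (-(hammingDist (h ∘ x) (c ∘ x) : ℝ)))) ≤
        Q s * (6 / α * massError w (f s) c + Real.exp (M - α / 8 * t)) := by
      intro s
      rw [iidMean.const_mul, iidMean.add, iidMean.const_mul, iidMean.const_mul, iidMean.sum,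
        iidMean_hammingDist hw, ← ht]
      refine mul_le_mul_of_nonneg_left ?_ (hQ.nonneg s)
      refine add_le_add (le_of_eq (by field_simp)) ?_
      have h1 : ∑ h ∈ Bad s, (iidMean w fun x : ι → Y =>
          Real.exp (-(hammingDist (h ∘ x) (c ∘ x) : ℝ))) ≤
          ∑ _h ∈ Bad s, Real.exp (-(5 / 8) * α * t) := by
        refine Finset.sum_le_sum fun h hh => (iidMean_exp_neg_hammingDist_le hw h c).trans ?_
        rw [Real.exp_le_exp, ← ht]
        have := (Finset.mem_filter.1 hh).2
        nlinarith
      rw [Finset.sum_const, nsmul_eq_mul] at h1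
      have h2 : ((Bad s).card : ℝ) ≤ Real.exp M :=
        le_trans (by exact_mod_cast Finset.card_filter_le _ _) (hM s)
      calc _ ≤ Real.exp (α / 2 * t) * (Real.exp M * Real.exp (-(5 / 8) * α * t)) :=
            mul_le_mul_of_nonneg_left (h1.trans
              (mul_le_mul_of_nonneg_right h2 (Real.exp_pos _).le)) (Real.exp_pos _).le
        _ = Real.exp (M - α / 8 * t) := by
            rw [← Real.exp_add, ← Real.exp_add]; congr 1; ring
    rw [iidMean.sum]
    refine (Finset.sum_le_sum fun s _ => hs s).trans ?_
    simp only [mul_add, Finset.sum_add_distrib, ← Finset.sum_mul, hQ.sum_eq_one, one_mul]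
    gcongr
    calc ∑ s, Q s * (6 / α * massError w (f s) c)
        = 6 / α * ∑ s, Q s * massError w (f s) c := by
          rw [Finset.mul_sum]; exact Finset.sum_congr rfl fun _ _ => by ring
      _ ≤ 6 / α * ρ := mul_le_mul_of_nonneg_left hρ (by positivity)
      _ = _ := by ring
  · intro x c' _ hdist
    rw [iidMean.const hw]
    have hsum : ∑ h, (∑ s, Q s * expMechanism (G s) x (c' ∘ x) h) *
        (if α < massError w h c then (1 : ℝ) else 0) =
        ∑ s, Q s * ∑ h, expMechanism (G s) x (c' ∘ x) h *
          (if α < massError w h c then (1 : ℝ) else 0) := by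
      simp only [Finset.sum_mul, Finset.mul_sum]
      rw [Finset.sum_comm]
      exact Finset.sum_congr rfl fun _ _ => Finset.sum_congr rfl fun _ _ => by ring
    rw [hsum]
    refine Finset.sum_le_sum fun s _ => mul_le_mul_of_nonneg_left ?_ (hQ.nonneg s)
    have hsecond : 0 ≤ Real.exp (α / 2 * t) *
        ∑ h ∈ Bad s, Real.exp (-(hammingDist (h ∘ x) (c ∘ x) : ℝ)) := by positivity
    -- Markov's inequality in pointwise form: if `f s` errs too often on the sample, the first term
    -- of the bound already exceeds 1.
    by_cases hbig : α / 6 * t < hammingDist (f s ∘ x) (c ∘ x)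
    · refine le_add_of_le_of_nonneg ?_ hsecond
      calc _ ≤ ∑ h, expMechanism (G s) x (c' ∘ x) h := Finset.sum_le_sum fun h _ =>
            mul_le_of_le_one_right (expMechanism_nonneg _ _ _ _) (by split_ifs <;> norm_num)
        _ = 1 := sum_expMechanism (hG s) _ _
        _ = 6 / (α * t) * (α / 6 * t) := by field_simp
        _ ≤ _ := mul_le_mul_of_nonneg_left hbig.le (by positivity)
    · refine le_add_of_nonneg_of_le (by positivity) ?_
      -- `f s` and the labeling concept are both within αt/6 of the target on the sample.
      have hZ : Real.exp (-(α / 3 * t)) ≤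
          ∑ g ∈ G s, Real.exp (-(hammingDist (g ∘ x) (c' ∘ x) : ℝ)) := by
        refine le_trans ?_ (Finset.single_le_sum
          (f := fun g => Real.exp (-(hammingDist (g ∘ x) (c' ∘ x) : ℝ)))
          (fun _ _ => (Real.exp_pos _).le) (hf s))
        rw [Real.exp_le_exp]
        have h1 : (hammingDist (f s ∘ x) (c' ∘ x) : ℝ) ≤
            hammingDist (f s ∘ x) (c ∘ x) + hammingDist (c' ∘ x) (c ∘ x) := by
          exact_mod_cast (hammingDist_triangle_right _ _ _)
        linarith
      have hZ0 := (Real.exp_pos _).trans_le hZ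
      have heq : ∑ h, expMechanism (G s) x (c' ∘ x) h *
          (if α < massError w h c then (1 : ℝ) else 0) =
          (∑ h ∈ Bad s, Real.exp (-(hammingDist (h ∘ x) (c' ∘ x) : ℝ))) /
            ∑ g ∈ G s, Real.exp (-(hammingDist (g ∘ x) (c' ∘ x) : ℝ)) := by
        rw [hBad, Finset.sum_filter, ← Finset.sum_filter_add_sum_filter_not Finset.univ (· ∈ G s),
          Finset.filter_univ_mem, Finset.sum_div]
        have h0 : ∑ h with h ∉ G s, expMechanism (G s) x (c' ∘ x) h *
            (if α < massError w h c then (1 : ℝ) else 0) = 0 :=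
          Finset.sum_eq_zero fun h hh => by
            simp [expMechanism, (Finset.mem_filter.1 hh).2]
        rw [h0, add_zero]
        refine Finset.sum_congr rfl fun h hh => ?_
        split_ifs <;> simp [expMechanism, hh]
      rw [heq, div_le_iff₀ hZ0]
      calc ∑ h ∈ Bad s, Real.exp (-(hammingDist (h ∘ x) (c' ∘ x) : ℝ))
          ≤ ∑ h ∈ Bad s, Real.exp (α / 6 * t) *
              Real.exp (-(hammingDist (h ∘ x) (c ∘ x) : ℝ)) := by
            refine Finset.sum_le_sum fun h _ => ?_
            rw [← Real.exp_add, Real.exp_le_exp]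
            have h1 : (hammingDist (h ∘ x) (c ∘ x) : ℝ) ≤
                hammingDist (h ∘ x) (c' ∘ x) + hammingDist (c' ∘ x) (c ∘ x) := by
              exact_mod_cast (hammingDist_triangle _ _ _)
            linarith
        _ = Real.exp (α / 2 * t) *
              (∑ h ∈ Bad s, Real.exp (-(hammingDist (h ∘ x) (c ∘ x) : ℝ))) *
              Real.exp (-(α / 3 * t)) := by
            rw [← Finset.mul_sum, mul_right_comm, ← Real.exp_add]
            congr 2
            ring
        _ ≤ _ := mul_le_mul_of_nonneg_left hZ hsecond

/-! ### The number of labelings realized by a class of bounded VC dimension -/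

/-- The usual bound (es/d)^d: after multiplication by (d/s)^d the sum is dominated by the binomial
expansion of (1 + d/s)^n ≤ e^d. -/
theorem sum_choose_le {n d d' : ℕ} {s : ℝ} (hd : 1 ≤ d) (hd' : d' ≤ d) (hn : (n : ℝ) ≤ s)
    (hds : (d : ℝ) ≤ s) :
    (∑ k ∈ Finset.Iic d', (n.choose k : ℝ)) ≤ Real.exp (d * (1 + Real.log (s / d))) := by
  have hd0 : (0 : ℝ) < d := by exact_mod_cast hd
  have hs0 : 0 < s := hd0.trans_le hds
  set l : ℝ := d / s with hl
  have hl0 : 0 < l := div_pos hd0 hs0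
  have hl1 : l ≤ 1 := (div_le_one hs0).2 hds
  have h1 : l ^ d * ∑ k ∈ Finset.Iic d', (n.choose k : ℝ) ≤ Real.exp d := by
    calc l ^ d * ∑ k ∈ Finset.Iic d', (n.choose k : ℝ)
        ≤ ∑ k ∈ Finset.Iic d', l ^ k * 1 ^ (n - k) * (n.choose k : ℝ) := by
          rw [Finset.mul_sum]
          refine Finset.sum_le_sum fun k hk => ?_
          rw [one_pow, mul_one]
          exact mul_le_mul_of_nonneg_right (pow_le_pow_of_le_one hl0.le hl1
            ((Finset.mem_Iic.1 hk).trans hd')) (Nat.cast_nonneg _)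
      _ = ∑ k ∈ Finset.Iic d' with k ∈ Finset.range (n + 1),
            l ^ k * 1 ^ (n - k) * (n.choose k : ℝ) := by
          refine (Finset.sum_filter_of_ne fun k _ hk => ?_).symm
          by_contra h
          rw [Finset.mem_range, not_lt, Nat.succ_le_iff] at h
          exact hk (by rw [Nat.choose_eq_zero_of_lt h]; simp)
      _ ≤ ∑ k ∈ Finset.range (n + 1), l ^ k * 1 ^ (n - k) * (n.choose k : ℝ) :=
          Finset.sum_le_sum_of_subset_of_nonneg (fun k hk => (Finset.mem_filter.1 hk).2)
            fun _ _ _ => by positivity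
      _ = (l + 1) ^ n := (add_pow l 1 n).symm
      _ ≤ Real.exp l ^ n := pow_le_pow_left₀ (by positivity) (Real.add_one_le_exp l) n
      _ = Real.exp (n * l) := (Real.exp_nat_mul _ _).symm
      _ ≤ Real.exp d := by
          rw [Real.exp_le_exp]
          calc (n : ℝ) * l ≤ s * l := mul_le_mul_of_nonneg_right hn hl0.le
            _ = d := by rw [hl]; field_simp
  have h2 : Real.exp (d * (1 + Real.log (s / d))) = Real.exp d / l ^ d := by
    rw [mul_add, mul_one, Real.exp_add, Real.exp_nat_mul, Real.exp_log (by positivity),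
      ← inv_div (d : ℝ) s, inv_pow, ← div_eq_mul_inv]
  rw [h2, le_div_iff₀ (by positivity), mul_comm]
  exact h1

/-- The Sauer-Shelah lemma for the trace read as a set family on the indices. Points may repeat in
x, so it remains to carry shattered index sets over to sets of points. -/
theorem card_trace_le_sum_choose {κ Y : Type*} [Fintype κ] [DecidableEq κ] {C : Set (Y → Bool)}
    {d : ℕ} (hC : ∀ B : Finset Y, (∀ z : Y → Bool, ∃ c ∈ C, ∀ b ∈ B, c b = z b) → B.card ≤ d)
    (x : κ → Y) : ∃ d' ≤ d, (trace C x).card ≤ ∑ k ∈ Finset.Iic d', (Fintype.card κ).choose k := by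
  classical
  set 𝒜 : Finset (Finset κ) := (trace C x).image fun z => Finset.univ.filter fun i => z i = true
    with h𝒜
  have hcard : 𝒜.card = (trace C x).card := by
    refine Finset.card_image_of_injective _ fun z z' h => funext fun i => ?_
    have := Finset.ext_iff.1 h i
    simp only [Finset.mem_filter, Finset.mem_univ, true_and] at this
    exact Bool.eq_iff_iff.2 this
  refine ⟨𝒜.vcDim, Finset.sup_le fun s hs => ?_, ?_⟩
  · rw [Finset.mem_shatterer] at hs
    have hex : ∀ t ⊆ s, ∃ c ∈ C, ∀ i ∈ s, (c (x i) = true ↔ i ∈ t) := by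
      intro t ht
      obtain ⟨u, hu, hsu⟩ := hs ht
      obtain ⟨z, hz, rfl⟩ := Finset.mem_image.1 hu
      obtain ⟨c, hc, rfl⟩ := mem_trace.1 hz
      refine ⟨c, hc, fun i hi => ?_⟩
      rw [← hsu]
      simp [hi]
    -- Shattering realizes the singleton {i}, which separates i from every other index; equal points
    -- could not be separated.
    have hinj : Set.InjOn x s := by
      intro i hi j hj hij
      obtain ⟨c, -, hc⟩ := hex {i} (Finset.singleton_subset_iff.2 hi)
      have h1 := hc i hi
      have h2 := hc j hj
      rw [← hij, h1] at h2
      simpa [eq_comm] using h2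
    rw [← Finset.card_image_of_injOn hinj]
    refine hC _ fun z => ?_
    obtain ⟨c, hc, h⟩ := hex (s.filter fun i => z (x i) = true) (Finset.filter_subset _ _)
    refine ⟨c, hc, fun y hy => ?_⟩
    obtain ⟨i, hi, rfl⟩ := Finset.mem_image.1 hy
    have := h i hi
    rw [Finset.mem_filter, and_iff_right hi] at this
    exact Bool.eq_iff_iff.2 this
  · rw [← hcard]
    exact (Finset.card_le_card_shatterer 𝒜).trans Finset.card_shatterer_le_sum_vcDim

theorem card_trace_le {κ Y : Type*} [Fintype κ] [DecidableEq κ] {C : Set (Y → Bool)}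
    {d : ℕ} (hC : ∀ B : Finset Y, (∀ z : Y → Bool, ∃ c ∈ C, ∀ b ∈ B, c b = z b) → B.card ≤ d)
    (hd : 1 ≤ d) {s : ℝ} (hκ : (Fintype.card κ : ℝ) ≤ s) (hds : (d : ℝ) ≤ s) (x : κ → Y) :
    ((trace C x).card : ℝ) ≤ Real.exp (d * (1 + Real.log (s / d))) := by
  obtain ⟨d', hd', h⟩ := card_trace_le_sum_choose hC x
  exact le_trans (by exact_mod_cast h) (sum_choose_le hd hd' hκ hds)

/-! ### Repeated relabeling -/

/-- With tolerance η/2^j and 8^j τ d points the exponent is d·2^j·η²τ/2, while the logarithm of the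
trace bound is d times a term linear in j. One τ therefore serves all d and j. The outer 9 counts
the failure events of a round (1 + 8); the inner one counts the points, at most 9 times the labeled
sample. -/
theorem exists_sample_size {η δ : ℝ} (hη : 0 < η) (hδ : 0 < δ) :
    ∃ τ : ℕ, 1 ≤ τ ∧ ∀ d : ℕ, 1 ≤ d → ∀ j : ℕ,
      9 * (Real.exp (d * (1 + Real.log (9 * 8 ^ j * τ))) *
        Real.exp (-((η / 2 ^ j) ^ 2 / 2 * (8 ^ j * τ * d)))) ≤ δ / 2 ^ j := by
  set K : ℝ := max 0 (Real.log (9 / δ)) with hK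
  have h1 : ∀ᶠ τ : ℕ in Filter.atTop, Real.log τ ≤ η ^ 2 / 4 * τ := by
    have h := Real.isLittleO_log_id_atTop.bound (by positivity : 0 < η ^ 2 / 4)
    filter_upwards [tendsto_natCast_atTop_atTop.eventually h] with τ hτ
    have hτ' : |Real.log (τ : ℝ)| ≤ η ^ 2 / 4 * |(τ : ℝ)| := hτ
    rw [Nat.abs_cast] at hτ'
    exact (le_abs_self _).trans hτ'
  -- The 4 covers 1 + log 9 as well as the increase log 8 + 1 per unit of j.
  have h2 : ∀ᶠ τ : ℕ in Filter.atTop, 4 + K ≤ η ^ 2 / 4 * τ :=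
    (tendsto_natCast_atTop_atTop.const_mul_atTop (by positivity : 0 < η ^ 2 / 4)).eventually
      (Filter.eventually_ge_atTop (4 + K))
  obtain ⟨τ, h1, h2, hτ⟩ := (h1.and (h2.and (Filter.eventually_ge_atTop 1))).exists
  refine ⟨τ, hτ, fun d hd j => ?_⟩
  have hτ0 : (0 : ℝ) < τ := by exact_mod_cast hτ
  have hd1 : (1 : ℝ) ≤ d := by exact_mod_cast hd
  have hK0 : 0 ≤ K := le_max_left _ _
  have hlog9 : Real.log 9 ≤ 3 := by
    rw [Real.log_le_iff_le_exp (by norm_num)]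
    have h := Real.exp_one_gt_d9
    have h3 : Real.exp 3 = Real.exp 1 ^ 3 := by rw [← Real.exp_nat_mul]; norm_num
    rw [h3]
    nlinarith [pow_le_pow_left₀ (by norm_num) h.le 3]
  have hlog8 : Real.log 8 ≤ 3 :=
    (Real.log_le_log (by norm_num) (by norm_num)).trans hlog9
  have hlog : Real.log (9 * 8 ^ j * τ) = Real.log 9 + j * Real.log 8 + Real.log τ := by
    rw [Real.log_mul (by positivity) hτ0.ne', Real.log_mul (by norm_num) (by positivity),
      Real.log_pow]
  have hpow : (8 : ℝ) ^ j = 2 ^ j * (2 ^ j * 2 ^ j) := by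
    rw [← mul_pow, ← mul_pow]; norm_num
  have hsq : (η / 2 ^ j) ^ 2 / 2 * (8 ^ j * τ * d) = d * (η ^ 2 / 2 * τ * 2 ^ j) := by
    rw [hpow]; field_simp
  have h2j : (1 : ℝ) + j ≤ 2 ^ j := by
    have := Nat.lt_two_pow_self (n := j)
    have h : 1 + j ≤ 2 ^ j := by omega
    exact_mod_cast h
  have hbr : 1 + Real.log (9 * 8 ^ j * τ) - η ^ 2 / 2 * τ * 2 ^ j ≤ -(K + j) := by
    rw [hlog]
    have hj0 : (0 : ℝ) ≤ j := Nat.cast_nonneg j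
    have h3 : (4 + K + Real.log τ) * (1 + j) ≤ η ^ 2 / 2 * τ * 2 ^ j :=
      mul_le_mul (by linarith) h2j (by positivity) (by positivity)
    have h4 : 0 ≤ Real.log τ := Real.log_nonneg (by exact_mod_cast hτ)
    nlinarith [mul_nonneg hj0 hK0, mul_nonneg hj0 h4, mul_le_mul_of_nonneg_left hlog8 hj0]
  have hexp : Real.exp (d * (1 + Real.log (9 * 8 ^ j * τ))) *
      Real.exp (-((η / 2 ^ j) ^ 2 / 2 * (8 ^ j * τ * d))) ≤ Real.exp (-(K + j)) := by
    rw [hsq, ← Real.exp_add, Real.exp_le_exp]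
    have h5 : 0 ≤ K + j := by positivity
    nlinarith
  have hKexp : 9 * Real.exp (-K) ≤ δ := by
    rw [Real.exp_neg, ← div_eq_mul_inv, div_le_iff₀ (Real.exp_pos _), ← div_le_iff₀' hδ]
    exact (Real.le_exp_log _).trans (Real.exp_le_exp.2 (le_max_right _ _))
  have hjexp : Real.exp (-(j : ℝ)) ≤ 1 / 2 ^ j := by
    rw [Real.exp_neg, one_div]
    refine inv_anti₀ (by positivity) ?_
    have h6 : (2 : ℝ) ≤ Real.exp 1 := by linarith [Real.exp_one_gt_d9]
    calc (2 : ℝ) ^ j ≤ Real.exp 1 ^ j := pow_le_pow_left₀ (by norm_num) h6 j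
      _ = Real.exp j := by rw [← Real.exp_nat_mul, mul_one]
  calc _ ≤ 9 * Real.exp (-(K + j)) := mul_le_mul_of_nonneg_left hexp (by norm_num)
    _ = 9 * Real.exp (-K) * Real.exp (-(j : ℝ)) := by rw [neg_add, Real.exp_add, mul_assoc]
    _ ≤ δ * (1 / 2 ^ j) := mul_le_mul hKexp hjexp (Real.exp_pos _).le hδ.le
    _ = _ := by ring

theorem IsAccurateAt.mono {ι κ Y O : Type*} [Fintype ι] [DecidableEq ι] [Fintype κ]
    [DecidableEq κ] [Fintype Y] [Fintype O] {C : Set (Y → Bool)} {c : Y → Bool} {w : Y → ℝ}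
    {b : O → ℝ} {θ θ' β β' : ℝ} {A : (ι → Y) → (ι → Bool) → (κ → Y) → O → ℝ}
    (hA : IsAccurateAt C c w b θ β A) (hθ : θ' ≤ θ) (hβ : β ≤ β') :
    IsAccurateAt C c w b θ' β' A := by
  obtain ⟨g, hg0, hgβ, hg⟩ := hA
  exact ⟨g, hg0, hgβ.trans hβ, fun x c' hc' h =>
    hg x c' hc' (h.trans (mul_le_mul_of_nonneg_right hθ (Nat.cast_nonneg _)))⟩

/-- Starting from a mechanism on at least `N` labeled points, repeated relabeling yields mechanisms
for smaller labeled samples; the privacy loss does not depend on the number `k` of rounds. -/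
theorem exists_relabeling_mechanism {Y O : Type*} [Fintype Y] [Fintype O] {C : Set (Y → Bool)}
    (hC : C.Nonempty) {τ d N : ℕ} (hd : 1 ≤ d) (hτ : 1 ≤ τ)
    (hVC : ∀ B : Finset Y, (∀ z : Y → Bool, ∃ c ∈ C, ∀ b ∈ B, c b = z b) → B.card ≤ d)
    {η δ : ℝ} (hη : 0 < η) (hη1 : η ≤ 1) (hδ : 0 < δ)
    (hsize : ∀ j : ℕ, 9 * (Real.exp (d * (1 + Real.log (9 * 8 ^ j * τ))) *
        Real.exp (-((η / 2 ^ j) ^ 2 / 2 * (8 ^ j * τ * d)))) ≤ δ / 2 ^ j)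
    {b : (Y → ℝ) → (Y → Bool) → O → ℝ} (hb : ∀ w c o, b w c o ≤ 1) {θ β : ℝ}
    (hbase : ∀ (ι : Type) [Fintype ι] [DecidableEq ι], N ≤ Fintype.card ι →
      ∃ A : (ι → Y) → (ι → Bool) → (Empty → Y) → O → ℝ,
        IsPrivateMechanism (Real.exp 1 * Real.exp 1) 1 A ∧
        ∀ c ∈ C, ∀ w, IsMass w → IsAccurateAt C c w (b w c) θ β A) (k : ℕ) :
    ∀ (j : ℕ) (ι : Type) [Fintype ι] [DecidableEq ι], Fintype.card ι = 8 ^ j * τ * d →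
      N ≤ 8 ^ k * Fintype.card ι →
      ∃ (κ : Type) (_ : Fintype κ) (_ : DecidableEq κ)
        (A : (ι → Y) → (ι → Bool) → (κ → Y) → O → ℝ),
        Fintype.card κ + 2 * Fintype.card ι ≤ 2 * 8 ^ k * Fintype.card ι ∧
        IsPrivateMechanism (2 * Real.exp 1 * (2 * Real.exp 1))
          (4 * (2 * Real.exp 1 * (2 * Real.exp 1))) A ∧
        ∀ c ∈ C, ∀ w, IsMass w → IsAccurateAt C c w (b w c) (θ - 4 * (η / 2 ^ j))
          (β + 2 * (δ / 2 ^ j)) A := by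
  have hexp1 : 1 ≤ Real.exp 1 := Real.one_le_exp zero_le_one
  -- k counts the remaining rounds and j the scale. The outermost relabeling has scale j and feeds a
  -- mechanism of scale j + 1. The pair of privacy factors is a fixed point of the relabeling step:
  -- the labeled factor is reset to (2e)^2, and four times it is the unlabeled one.
  induction k with
  | zero =>
    intro j ι _ _ _ hN
    obtain ⟨A, hA, hacc⟩ := hbase ι (by simpa using hN)
    refine ⟨Empty, inferInstance, inferInstance, A, by simp, hA.mono (by nlinarith) (by nlinarith),
      fun c hc w hw => (hacc c hc w hw).mono ?_ ?_⟩
    · have : 0 < η / 2 ^ j := by positivity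
      linarith
    · have : 0 < δ / 2 ^ j := by positivity
      linarith
  | succ k ih =>
    intro j ι _ _ hι hN
    have hcard8 : Fintype.card (ι × Fin 8) = 8 * Fintype.card ι := by
      rw [Fintype.card_prod, Fintype.card_fin, mul_comm]
    obtain ⟨κ, _, _, A, hκ, hA, hacc⟩ := ih (j + 1) (ι × Fin 8)
      (by rw [hcard8, hι]; ring) (by rw [hcard8]; refine hN.trans_eq ?_; ring)
    refine ⟨ι × Fin 8 ⊕ κ, inferInstance, inferInstance, relabel C A, ?_,
      isPrivateMechanism_relabel hC (by positivity) hA le_rfl le_rfl, fun c hc w hw => ?_⟩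
    · rw [Fintype.card_sum]
      rw [hcard8] at hκ ⊢
      have : 2 * 8 ^ (k + 1) * Fintype.card ι = 2 * 8 ^ k * (8 * Fintype.card ι) := by ring
      omega
    · set t : ℝ := 8 ^ j * τ * d with ht
      have hιt : (Fintype.card ι : ℝ) = t := by rw [hι, ht]; push_cast; rfl
      have hd0 : (0 : ℝ) < d := by exact_mod_cast hd
      have hτ1 : (1 : ℝ) ≤ τ := by exact_mod_cast hτ
      have h8 : (1 : ℝ) ≤ 8 ^ j := one_le_pow₀ (by norm_num)
      have htd : (d : ℝ) ≤ t := le_mul_of_one_le_left hd0.le (by nlinarith)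
      have hdiv : 9 * t / d = 9 * 8 ^ j * τ := by rw [ht]; field_simp
      set B : ℝ := Real.exp (d * (1 + Real.log (9 * 8 ^ j * τ))) with hB
      set η' : ℝ := η / 2 ^ j with hη'
      have hη'0 : 0 < η' := by positivity
      have hη'1 : η' ≤ 1 := (div_le_self hη.le (one_le_pow₀ (by norm_num))).trans hη1
      have htr : ∀ (I : Type) [Fintype I] [DecidableEq I], Fintype.card I ≤ 9 * Fintype.card ι →
          ∀ X : I → Y, ((trace C X).card : ℝ) ≤ B := by
        intro I _ _ hI X
        have h := card_trace_le hVC hd (s := 9 * t) (by rw [← hιt]; exact_mod_cast hI)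
          (by linarith) X
        rwa [hdiv] at h
      have hstep := isAccurateAt_relabel (ι := ι) hw (hb w c) hA (hacc c hc w hw) hη'0.le
        (htr _ (by rw [Fintype.card_sum, hcard8]; omega))
        (htr _ (by rw [Fintype.card_prod, Fintype.card_bool]; omega))
      -- The budgets are geometric tails: 4·(η'/2) + 2η' = 4η' for the tolerance, and 2·(δ'/2) + δ'
      -- = 2δ' with δ' = δ/2^j for the failure probability.
      have h1 : η / 2 ^ (j + 1) = η' / 2 := by rw [hη', pow_succ]; field_simp
      have h2 : δ / 2 ^ (j + 1) = δ / 2 ^ j / 2 := by rw [pow_succ]; field_simp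
      rw [h1, h2, hιt] at hstep
      refine hstep.mono (by linarith) ?_
      have h3 := hsize j
      have h4 : Real.exp (-(η' * t)) ≤ Real.exp (-(η' ^ 2 / 2 * t)) := by
        rw [Real.exp_le_exp, neg_le_neg_iff]
        exact mul_le_mul_of_nonneg_right (by nlinarith) (hd0.le.trans htd)
      have h5 := mul_le_mul_of_nonneg_left h4 (Real.exp_pos _ : 0 < B).le
      linarith

/-! ### Privacy amplification by subsampling -/

/-- The single exceptional value is at most a times each of the other q - 1 values, hence at most
a/(q - 1) times their sum. -/
theorem sum_le_of_eq_off {q : ℕ} (hq : 2 ≤ q) {a : ℝ} {φ₁ φ₂ : Fin q → ℝ}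
    {l : Fin q} (h0 : ∀ i, 0 ≤ φ₂ i) (heq : ∀ i, i ≠ l → φ₁ i = φ₂ i)
    (hle : ∀ i, φ₁ l ≤ a * φ₂ i) (ha : 0 ≤ a) :
    ∑ i, φ₁ i ≤ (1 + a / (q - 1)) * ∑ i, φ₂ i := by
  classical
  have hq1 : (0 : ℝ) < q - 1 := by
    have : (2 : ℝ) ≤ q := by exact_mod_cast hq
    linarith
  have h1 : ∑ i ∈ Finset.univ.erase l, φ₁ i = ∑ i ∈ Finset.univ.erase l, φ₂ i :=
    Finset.sum_congr rfl fun i hi => heq i (Finset.ne_of_mem_erase hi)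
  have h2 : (q - 1 : ℝ) * φ₁ l ≤ a * ∑ i ∈ Finset.univ.erase l, φ₂ i := by
    rw [Finset.mul_sum]
    refine le_trans (le_of_eq ?_) (Finset.sum_le_sum fun i _ => hle i)
    rw [Finset.sum_const, Finset.card_erase_of_mem (Finset.mem_univ l), Finset.card_univ,
      Fintype.card_fin, nsmul_eq_mul, Nat.cast_sub (by omega), Nat.cast_one]
  rw [← Finset.add_sum_erase _ φ₁ (Finset.mem_univ l), ← Finset.add_sum_erase _ φ₂
    (Finset.mem_univ l), h1]
  set s := ∑ i ∈ Finset.univ.erase l, φ₂ i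
  have h3 : φ₁ l ≤ a / (q - 1) * s := by
    rw [div_mul_eq_mul_div, le_div_iff₀ hq1]
    linarith
  have h4 := h0 l
  have h5 : 0 ≤ a / (q - 1 : ℝ) * φ₂ l := by positivity
  nlinarith

theorem sum_choice_le {ι : Type*} [Fintype ι] [DecidableEq ι] {q : ℕ} (hq : 2 ≤ q) {a : ℝ}
    {Φ₁ Φ₂ : (ι → Fin q) → ℝ} {j : ι} {l : Fin q} (h0 : ∀ f, 0 ≤ Φ₂ f)
    (heq : ∀ f, f j ≠ l → Φ₁ f = Φ₂ f)
    (hle : ∀ f f', (∀ i ≠ j, f i = f' i) → Φ₁ f ≤ a * Φ₂ f') (ha : 0 ≤ a) :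
    ∑ f, Φ₁ f ≤ (1 + a / (q - 1)) * ∑ f, Φ₂ f := by
  have hsplit : ∀ Φ : (ι → Fin q) → ℝ, ∑ f, Φ f =
      ∑ r : {i // i ≠ j} → Fin q, ∑ i, Φ ((Equiv.funSplitAt j (Fin q)).symm (i, r)) := by
    intro Φ
    rw [← (Equiv.funSplitAt j (Fin q)).symm.sum_comp, Fintype.sum_prod_type_right]
  rw [hsplit, hsplit, Finset.mul_sum]
  refine Finset.sum_le_sum fun r _ => sum_le_of_eq_off (l := l) hq (fun i => h0 _)
    (fun i hi => heq _ ?_) (fun i => hle _ _ fun i' hi' => ?_) ha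
  · simpa [Equiv.funSplitAt, Equiv.piSplitAt] using hi
  · simp [Equiv.funSplitAt, Equiv.piSplitAt, hi']

/-- Apply `A` to a sample that contains one uniformly random point of each block of size `q`. -/
noncomputable def subsample {ι κ Y O : Type*} [Fintype ι] [DecidableEq ι] [Fintype κ]
    [DecidableEq κ] (q : ℕ) (A : (ι → Y) → (ι → Bool) → (κ → Y) → O → ℝ) (x : ι × Fin q → Y)
    (y : ι × Fin q → Bool) (v : κ × Fin q → Y) (o : O) : ℝ :=
  ((q : ℝ) ^ Fintype.card ι * (q : ℝ) ^ Fintype.card κ)⁻¹ *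
    ∑ f : ι → Fin q, ∑ g : κ → Fin q,
      A (fun i => x (i, f i)) (fun i => y (i, f i)) (fun i => v (i, g i)) o

section subsample

variable {ι κ Y O : Type*} [Fintype ι] [DecidableEq ι] [Fintype κ] [DecidableEq κ] [Fintype O]

theorem subsample_const {q : ℕ} (hq : 2 ≤ q) (a : ℝ) :
    ((q : ℝ) ^ Fintype.card ι * (q : ℝ) ^ Fintype.card κ)⁻¹ *
      ∑ _f : ι → Fin q, ∑ _g : κ → Fin q, a = a := by
  have hq0 : (q : ℝ) ≠ 0 := by
    have : q ≠ 0 := by omega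
    exact_mod_cast this
  simp only [Finset.sum_const, Finset.card_univ, Fintype.card_fun, Fintype.card_fin, nsmul_eq_mul]
  push_cast
  field_simp

/-- Only selections that pick the changed point are affected. Replacing that pick by another point
of its block gives an input of `A` that differs in one entry, so such a selection is compared with
the q - 1 unaffected ones. -/
theorem isPrivateMechanism_subsample {q : ℕ} (hq : 2 ≤ q) {a b : ℝ} (ha : 0 ≤ a) (hb : 0 ≤ b)
    {A : (ι → Y) → (ι → Bool) → (κ → Y) → O → ℝ} (hA : IsPrivateMechanism a b A) :
    IsPrivateMechanism (1 + a / (q - 1)) (1 + b / (q - 1)) (subsample q A) where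
  nonneg x y v o := mul_nonneg (by positivity)
    (Finset.sum_nonneg fun _ _ => Finset.sum_nonneg fun _ _ => hA.nonneg _ _ _ _)
  sum_eq_one x y v := by
    simp only [subsample]
    rw [← Finset.mul_sum, Finset.sum_comm]
    rw [Finset.sum_congr rfl fun f _ => Finset.sum_comm]
    simp only [hA.sum_eq_one]
    exact subsample_const hq 1
  labeled := by
    rintro ⟨j, l⟩ x x' y y' hx hy v o
    simp only [subsample]
    rw [mul_left_comm]
    refine mul_le_mul_of_nonneg_left ?_ (by positivity)
    refine sum_choice_le (j := j) (l := l) hq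
      (fun f => Finset.sum_nonneg fun g _ => hA.nonneg _ _ _ _) (fun f hf => ?_)
      (fun f f' hff => ?_) ha
    · have hne : ∀ i, (i, f i) ≠ (j, l) := fun i h => by
        obtain ⟨h1, h2⟩ := Prod.mk.inj h
        exact hf (h1 ▸ h2)
      simp only [hx _ (hne _), hy _ (hne _)]
    · rw [Finset.mul_sum]
      refine Finset.sum_le_sum fun g _ => hA.labeled j _ _ _ _ (fun i hi => ?_) (fun i hi => ?_) _ _
      · rw [hff i hi]
        exact hx _ fun h => hi (Prod.mk.inj h).1
      · rw [hff i hi]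
        exact hy _ fun h => hi (Prod.mk.inj h).1
  unlabeled := by
    rintro ⟨j, l⟩ x y v v' hv o
    simp only [subsample]
    rw [mul_left_comm]
    refine mul_le_mul_of_nonneg_left ?_ (by positivity)
    rw [Finset.mul_sum]
    refine Finset.sum_le_sum fun f _ => ?_
    refine sum_choice_le (j := j) (l := l) hq
      (fun g => hA.nonneg _ _ _ _) (fun g hg => ?_) (fun g g' hgg => ?_) hb
    · have hne : ∀ i, (i, g i) ≠ (j, l) := fun i h => by
        obtain ⟨h1, h2⟩ := Prod.mk.inj h
        exact hg (h1 ▸ h2)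
      simp only [hv _ (hne _)]
    · refine hA.unlabeled j _ _ _ _ (fun i hi => ?_) _
      rw [hgg i hi]
      exact hv _ fun h => hi (Prod.mk.inj h).1

/-- For each fixed selection the chosen points sit at distinct positions and so are again i.i.d.;
subsampling costs no accuracy. -/
theorem iidMean_subsample [Fintype Y] {w : Y → ℝ} (hw : IsMass w) {q : ℕ} (hq : 2 ≤ q)
    (A : (ι → Y) → (ι → Bool) → (κ → Y) → O → ℝ) (c : Y → Bool) (b : O → ℝ) :
    (iidMean w fun x : ι × Fin q → Y => iidMean w fun v : κ × Fin q → Y =>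
      ∑ o, subsample q A x (c ∘ x) v o * b o) =
    iidMean w fun x : ι → Y => iidMean w fun v : κ → Y => ∑ o, A x (c ∘ x) v o * b o := by
  have h1 : ∀ (x : ι × Fin q → Y) (v : κ × Fin q → Y),
      ∑ o, subsample q A x (c ∘ x) v o * b o =
      ((q : ℝ) ^ Fintype.card ι * (q : ℝ) ^ Fintype.card κ)⁻¹ *
        ∑ f : ι → Fin q, ∑ g : κ → Fin q, ∑ o, A (fun i => x (i, f i)) (c ∘ fun i => x (i, f i))
          (fun i => v (i, g i)) o * b o := by
    intro x v
    simp only [subsample, mul_assoc, ← Finset.mul_sum, Finset.sum_mul]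
    congr 1
    rw [Finset.sum_comm]
    exact Finset.sum_congr rfl fun f _ => Finset.sum_comm
  have hinj : ∀ f : ι → Fin q, Function.Injective fun i => (i, f i) :=
    fun f i i' h => (Prod.mk.inj h).1
  have hinj' : ∀ f : κ → Fin q, Function.Injective fun i => (i, f i) :=
    fun f i i' h => (Prod.mk.inj h).1
  simp only [h1, iidMean.const_mul, iidMean.sum]
  refine Eq.trans ?_ (subsample_const (ι := ι) (κ := κ) hq _)
  congr 1
  refine Finset.sum_congr rfl fun f _ => Finset.sum_congr rfl fun g _ => ?_
  have h2 : ∀ x : ι × Fin q → Y, (iidMean w fun v : κ × Fin q → Y => ∑ o, A (fun i => x (i, f i))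
      (c ∘ fun i => x (i, f i)) (fun i => v (i, g i)) o * b o) =
      iidMean w fun v : κ → Y => ∑ o, A (fun i => x (i, f i))
        (c ∘ fun i => x (i, f i)) v o * b o := fun x =>
    iidMean.marginal hw (hinj' g) fun v => ∑ o, A (fun i => x (i, f i))
        (c ∘ fun i => x (i, f i)) v o * b o
  simp only [← iidMean.sum, h2]
  exact iidMean.marginal hw (hinj f) fun x => iidMean w fun v : κ → Y => ∑ o, A x (c ∘ x) v o * b o

end subsample

/-! ### Private semi-supervised learning over a finite domain -/

theorem exists_blockSize {a ε : ℝ} (hε : 0 < ε) :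
    ∃ q : ℕ, 2 ≤ q ∧ 1 + a / (q - 1) ≤ Real.exp ε := by
  obtain ⟨q, hq⟩ := exists_nat_ge (a / ε)
  refine ⟨q + 2, by omega, ?_⟩
  have hq0 : (0 : ℝ) < q + 2 - 1 := by linarith [(Nat.cast_nonneg q : (0 : ℝ) ≤ q)]
  have h : a / (q + 2 - 1 : ℝ) ≤ ε := by
    rw [div_le_iff₀ hq0]
    rw [div_le_iff₀ hε] at hq
    nlinarith
  push_cast
  linarith [Real.add_one_le_exp ε]

theorem IsAccurateAt.iidMean_le {ι κ Y O : Type*} [Fintype ι] [DecidableEq ι] [Fintype κ]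
    [DecidableEq κ] [Fintype Y] [Fintype O] {C : Set (Y → Bool)} {c : Y → Bool} {w : Y → ℝ}
    {b : O → ℝ} {θ β : ℝ} {A : (ι → Y) → (ι → Bool) → (κ → Y) → O → ℝ} (hw : IsMass w)
    (hc : c ∈ C) (hθ : 0 ≤ θ) (hA : IsAccurateAt C c w b θ β A) :
    (iidMean w fun x => iidMean w fun v => ∑ o, A x (c ∘ x) v o * b o) ≤ β := by
  obtain ⟨g, -, hgβ, hg⟩ := hA
  refine (iidMean.mono hw fun x => hg x c hc ?_).trans hgβ
  rw [hammingDist_self, Nat.cast_zero]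
  positivity

/-- Private learning with few labeled points, up to a constant privacy loss. -/
theorem exists_private_learner_aux {α β : ℝ} (hα : 0 < α) (hβ : 0 < β) :
    ∃ K₁ K₂ : ℕ, ∀ {Y R : Type*} [Fintype Y] [DecidableEq Y] [Fintype R] {C : Set (Y → Bool)}
      (_ : C.Nonempty) {H : R → Finset (Y → Bool)} {P : R → ℝ} (_ : IsMass P)
      (_ : ∀ i, (H i).Nonempty) (_ : IsMassRepresentation C H P) {L : ℝ} (_ : 1 / 2 ≤ L)
      (_ : ∀ i, ((H i).card : ℝ) ≤ Real.exp L) {d : ℕ∞} (_ : 1 ≤ d)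
      (_ : ∀ B : Finset Y, (∀ z : Y → Bool, ∃ c ∈ C, ∀ b ∈ B, c b = z b) → (B.card : ℕ∞) ≤ d),
      ∃ (ι κ : Type) (_ : Fintype ι) (_ : DecidableEq ι) (_ : Fintype κ) (_ : DecidableEq κ)
        (A : (ι → Y) → (ι → Bool) → (κ → Y) → (Y → Bool) → ℝ),
        (Fintype.card ι : ℕ∞) ≤ K₁ * d ∧ (Fintype.card ι + Fintype.card κ : ℝ) ≤ K₂ * L ∧
        IsPrivateMechanism (2 * Real.exp 1 * (2 * Real.exp 1))
          (4 * (2 * Real.exp 1 * (2 * Real.exp 1))) A ∧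
        ∀ c ∈ C, ∀ w, IsMass w → (iidMean w fun x => iidMean w fun v =>
          ∑ f, A x (c ∘ x) v f * if α < massError w f c then 1 else 0) ≤ β := by
  -- The boosted error makes the Markov term 6·(127/128)^T/α of the exponential mechanism at most
  -- β/4.
  obtain ⟨T, hT⟩ := exists_pow_lt_of_lt_one (by positivity : 0 < β * α / 24)
    (by norm_num : (127 / 128 : ℝ) < 1)
  -- All rounds together use tolerance 4η ≤ α/6, which is what the base learner allows. Likewise 2 ·
  -- β/4 is the part of β that the base learner leaves.
  set η : ℝ := min (α / 24) 1 with hη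
  have hη0 : 0 < η := lt_min (by positivity) one_pos
  obtain ⟨τ, hτ, hsize⟩ := exists_sample_size hη0 (by positivity : 0 < β / 4)
  obtain ⟨K, hK⟩ := exists_nat_ge (8 * T / α + 16 * |Real.log (4 / β)| / α + 4)
  refine ⟨τ, 16 * K, fun {Y R} _ _ _ {C} hC {H P} hP hH hrep {L} hL hcard {d} hd hVC => ?_⟩
  -- N is large enough for exp(TL - αN/8) ≤ β/4. Since L ≥ 1/2, its additive constants are absorbed
  -- into a multiple of L.
  obtain ⟨Q, G, hQ, hGne, hGcard, hG⟩ := exists_boosted_representation hP hH hrep hcard T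
  set N : ℕ := ⌈8 * (T * L + |Real.log (4 / β)|) / α⌉₊ + 1 with hN
  have hN_ge : 8 * (T * L + |Real.log (4 / β)|) / α ≤ N := by
    rw [hN]; push_cast; linarith [Nat.le_ceil (8 * (T * L + |Real.log (4 / β)|) / α)]
  have hN_le : (N : ℝ) ≤ K * L := by
    have h1 : (N : ℝ) < 8 * (T * L + |Real.log (4 / β)|) / α + 1 + 1 := by
      rw [hN]; push_cast
      have := Nat.ceil_lt_add_one
        (by positivity : 0 ≤ 8 * (T * L + |Real.log (4 / β)|) / α)
      linarith
    have h2 : (8 * T / α + 16 * |Real.log (4 / β)| / α + 4) * L ≤ K * L :=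
      mul_le_mul_of_nonneg_right hK (by linarith)
    have h3 : 0 ≤ 16 * |Real.log (4 / β)| / α * (L - 1 / 2) :=
      mul_nonneg (by positivity) (by linarith)
    have h4 : 8 * (T * L + |Real.log (4 / β)|) / α =
      8 * T / α * L + 16 * |Real.log (4 / β)| / α * (1 / 2) := by ring
    nlinarith
  have hbase : ∀ (ι : Type) [Fintype ι] [DecidableEq ι], N ≤ Fintype.card ι →
      ∃ A : (ι → Y) → (ι → Bool) → (Empty → Y) → (Y → Bool) → ℝ,
        IsPrivateMechanism (Real.exp 1 * Real.exp 1) 1 A ∧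
        ∀ c ∈ C, ∀ w, IsMass w → IsAccurateAt C c w
          (fun f => if α < massError w f c then (1 : ℝ) else 0) (α / 6) (β / 2) A := by
    intro ι _ _ hι
    have : Nonempty ι := Fintype.card_pos_iff.1 (by omega)
    refine ⟨_, isPrivateMechanism_expMechanism hQ hGne, fun c hc w hw => ?_⟩
    obtain ⟨f, hf, hfle⟩ := hG c hc w hw
    refine (isAccurateAt_expMechanism hw hQ hGne hGcard hf hfle hα).mono le_rfl ?_
    have h1 : 6 * (127 / 128) ^ T / α ≤ β / 4 := by
      rw [div_le_iff₀ hα]; linarith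
    have h2 : Real.exp (T * L - α / 8 * Fintype.card ι) ≤ β / 4 := by
      rw [← Real.le_log_iff_exp_le (by positivity)]
      have h3 : (N : ℝ) ≤ Fintype.card ι := by exact_mod_cast hι
      have h4 : T * L + |Real.log (4 / β)| ≤ α / 8 * Fintype.card ι := by
        have h5 := hN_ge.trans h3
        rw [div_le_iff₀ hα] at h5
        linarith
      have h6 : Real.log (β / 4) = -Real.log (4 / β) := by rw [← Real.log_inv, inv_div]
      rw [h6]
      linarith [le_abs_self (Real.log (4 / β))]
    linarith
  -- If τd labels are already enough for the base learner (in particular if d is infinite), no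
  -- relabeling is needed.
  by_cases hcase : (N : ℕ∞) ≤ τ * d
  · obtain ⟨A, hA, hacc⟩ := hbase (Fin N) (by simp)
    have hexp1 : 1 ≤ Real.exp 1 := Real.one_le_exp zero_le_one
    refine ⟨Fin N, Empty, inferInstance, inferInstance, inferInstance, inferInstance, A,
      by simpa using hcase, ?_, hA.mono (by nlinarith) (by nlinarith), fun c hc w hw => ?_⟩
    · simp only [Fintype.card_fin, Fintype.card_empty, Nat.cast_zero, add_zero]
      push_cast
      nlinarith
    · exact ((hacc c hc w hw).iidMean_le hw hc (by positivity)).trans (by linarith)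
  · have hdtop : d ≠ ⊤ := by
      rintro rfl
      refine hcase ?_
      rw [ENat.mul_top (by exact_mod_cast (by omega : τ ≠ 0))]
      exact le_top
    lift d to ℕ using hdtop
    have hd1 : 1 ≤ d := by exact_mod_cast hd
    have hlt : τ * d < N := by
      rw [not_le] at hcase
      exact_mod_cast hcase
    have hτd : 1 ≤ τ * d := Nat.mul_pos hτ hd1
    have hex : ∃ k, N ≤ 8 ^ k * (τ * d) :=
      ⟨N, (Nat.lt_pow_self (by norm_num)).le.trans (Nat.le_mul_of_pos_right _ hτd)⟩
    classical
    -- The least sufficient number of rounds overshoots N by at most the factor 8, so the total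
    -- sample has size at most 16N.
    obtain ⟨k, hk, hk_le⟩ : ∃ k, N ≤ 8 ^ k * (τ * d) ∧ 8 ^ k * (τ * d) ≤ 8 * N := by
      refine ⟨Nat.find hex, Nat.find_spec hex, ?_⟩
      rcases h : Nat.find hex with _ | k
      · simp; omega
      · have := Nat.find_min hex (m := k) (by omega)
        rw [pow_succ]
        nlinarith
    obtain ⟨κ, _, _, A, hκ, hA, hacc⟩ := exists_relabeling_mechanism hC hd1 hτ
      (fun B hB => by exact_mod_cast hVC B hB) hη0 (min_le_right _ _) (by positivity)
      (hsize d hd1) (b := fun w c f => if α < massError w f c then (1 : ℝ) else 0)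
      (fun w c o => by split_ifs <;> norm_num) hbase k 0 (Fin (τ * d)) (by simp)
      (by simpa using hk)
    refine ⟨Fin (τ * d), κ, inferInstance, inferInstance, inferInstance, inferInstance, A,
      by simp, ?_, hA, fun c hc w hw => ?_⟩
    · have h1 : Fintype.card (Fin (τ * d)) + Fintype.card κ ≤ 16 * N := by
        rw [Fintype.card_fin] at hκ ⊢
        nlinarith
      have h2 : (Fintype.card (Fin (τ * d)) + Fintype.card κ : ℝ) ≤ 16 * N := by exact_mod_cast h1
      push_cast
      linarith
    · refine ((hacc c hc w hw).iidMean_le hw hc ?_).trans ?_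
      · have := min_le_left (α / 24) 1
        simp only [pow_zero, div_one]
        linarith
      · simp only [pow_zero, div_one]
        linarith

theorem exists_private_learner {α β ε : ℝ} (hα : 0 < α) (hβ : 0 < β) (hε : 0 < ε) :
    ∃ K₁ K₂ : ℕ, ∀ {Y R : Type*} [Fintype Y] [DecidableEq Y] [Fintype R] {C : Set (Y → Bool)}
      (_ : C.Nonempty) {H : R → Finset (Y → Bool)} {P : R → ℝ} (_ : IsMass P)
      (_ : ∀ i, (H i).Nonempty) (_ : IsMassRepresentation C H P) {L : ℝ} (_ : 1 / 2 ≤ L)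
      (_ : ∀ i, ((H i).card : ℝ) ≤ Real.exp L) {d : ℕ∞} (_ : 1 ≤ d)
      (_ : ∀ B : Finset Y, (∀ z : Y → Bool, ∃ c ∈ C, ∀ b ∈ B, c b = z b) → (B.card : ℕ∞) ≤ d),
      ∃ (ι κ : Type) (_ : Fintype ι) (_ : DecidableEq ι) (_ : Fintype κ) (_ : DecidableEq κ)
        (A : (ι → Y) → (ι → Bool) → (κ → Y) → (Y → Bool) → ℝ),
        (Fintype.card ι : ℕ∞) ≤ K₁ * d ∧ (Fintype.card ι + Fintype.card κ : ℝ) ≤ K₂ * L ∧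
        IsPrivateMechanism (Real.exp ε) (Real.exp ε) A ∧
        ∀ c ∈ C, ∀ w, IsMass w → (iidMean w fun x => iidMean w fun v =>
          ∑ f, A x (c ∘ x) v f * if α < massError w f c then 1 else 0) ≤ β := by
  obtain ⟨K₁, K₂, h⟩ := exists_private_learner_aux hα hβ
  obtain ⟨q, hq, hqε⟩ := exists_blockSize (a := 4 * (2 * Real.exp 1 * (2 * Real.exp 1))) hε
  refine ⟨q * K₁, q * K₂, fun {Y R} _ _ _ {C} hC {H P} hP hH hrep {L} hL hcard {d} hd hVC => ?_⟩
  obtain ⟨ι, κ, _, _, _, _, A, hι, hικ, hA, hacc⟩ := h hC hP hH hrep hL hcard hd hVC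
  have hq1 : (0 : ℝ) < q - 1 := by
    have : (2 : ℝ) ≤ q := by exact_mod_cast hq
    linarith
  have hle : 1 + 2 * Real.exp 1 * (2 * Real.exp 1) / (q - 1) ≤ Real.exp ε := by
    refine le_trans (add_le_add_right (div_le_div_of_nonneg_right ?_ hq1.le) 1) hqε
    have : 0 < 2 * Real.exp 1 * (2 * Real.exp 1) := by positivity
    linarith
  refine ⟨ι × Fin q, κ × Fin q, inferInstance, inferInstance, inferInstance, inferInstance,
    subsample q A, ?_, ?_, (isPrivateMechanism_subsample hq (by positivity) (by positivity)
      hA).mono hle hqε, fun c hc w hw => ?_⟩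
  · rw [Fintype.card_prod, Fintype.card_fin]
    push_cast
    rw [mul_comm (Fintype.card ι : ℕ∞), mul_assoc]
    gcongr
  · rw [Fintype.card_prod, Fintype.card_prod, Fintype.card_fin]
    push_cast
    have : (0 : ℝ) ≤ q := Nat.cast_nonneg q
    nlinarith
  · rw [iidMean_subsample hw hq A c fun f => if α < massError w f c then 1 else 0]
    exact hacc c hc w hw

/-! ### From a finite domain to measurable spaces -/

section transfer

variable {X Y ι κ : Type*} [MeasurableSpace X] [Fintype Y] [MeasurableSpace Y]
  [MeasurableSingletonClass Y]

/-- The concept `f ∘ φ`. -/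
def BoolConcept.pullback {φ : X → Y} (hφ : Measurable φ) (f : Y → Bool) : BoolConcept X :=
  ⟨f ∘ φ, (Measurable.of_discrete).comp hφ⟩

theorem isMass_map (μ : Measure X) [IsProbabilityMeasure μ] {φ : X → Y} (hφ : Measurable φ) :
    IsMass fun y => (μ.map φ).real {y} where
  nonneg _ := measureReal_nonneg
  sum_eq_one := by
    have := Measure.isProbabilityMeasure_map (μ := μ) hφ.aemeasurable
    rw [sum_measureReal_singleton, Finset.coe_univ, probReal_univ]

theorem genError_pullback (μ : Measure X) [IsProbabilityMeasure μ] {φ : X → Y}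
    (hφ : Measurable φ) (c f : Y → Bool) :
    genError μ (BoolConcept.pullback hφ c) (BoolConcept.pullback hφ f) =
      massError (fun y => (μ.map φ).real {y}) f c := by
  have := Measure.isProbabilityMeasure_map (μ := μ) hφ.aemeasurable
  have h1 : genError μ (BoolConcept.pullback hφ c) (BoolConcept.pullback hφ f) =
      (μ.map φ).real {y | f y ≠ c y} := by
    rw [map_measureReal_apply hφ (Set.toFinite _).measurableSet]
    rfl
  have h2 : ({y | f y ≠ c y} : Set Y) = ↑(Finset.univ.filter fun y => f y ≠ c y) := by
    ext; simp
  rw [h1, h2, ← sum_measureReal_singleton, Finset.sum_filter]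
  simp only [massError, mul_ite, mul_one, mul_zero]

theorem lintegral_comp_eq_iidMean (μ : Measure X) [IsProbabilityMeasure μ] {φ : X → Y}
    (hφ : Measurable φ) {n : ℕ} {g : (Fin n → Y) → ℝ} (hg : ∀ y, 0 ≤ g y) :
    ∫⁻ x, ENNReal.ofReal (g fun i => φ (x i)) ∂(Measure.pi fun _ : Fin n => μ) =
      ENNReal.ofReal (iidMean (fun y => (μ.map φ).real {y}) g) := by
  have := Measure.isProbabilityMeasure_map (μ := μ) hφ.aemeasurable
  have h1 : Measurable fun (x : Fin n → X) i => φ (x i) :=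
    measurable_pi_lambda _ fun i => hφ.comp (measurable_pi_apply i)
  have h2 : Measurable fun y : Fin n → Y => ENNReal.ofReal (g y) := Measurable.of_discrete
  rw [← lintegral_map h2 h1, Measure.pi_map_pi fun _ => hφ.aemeasurable, lintegral_fintype,
    iidMean, ENNReal.ofReal_sum_of_nonneg fun y _ => mul_nonneg
      (Finset.prod_nonneg fun _ _ => measureReal_nonneg) (hg y)]
  refine Finset.sum_congr rfl fun y _ => ?_
  rw [Measure.pi_singleton, mul_comm, ENNReal.ofReal_mul
    (Finset.prod_nonneg fun _ _ => measureReal_nonneg),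
    ENNReal.ofReal_prod_of_nonneg fun _ _ => measureReal_nonneg]
  congr 1
  exact Finset.prod_congr rfl fun i _ => (ofReal_measureReal (measure_ne_top _ _)).symm

variable [DecidableEq Y] [Fintype ι] [Fintype κ]

/-- The mechanism `A` on databases of size `n`, as a kernel: the entries are mapped to `Y` by `φ`,
those with index in `e ∘ Sum.inl` are used with their labels, and the output is pulled back
to `X`. -/
noncomputable def mechanismKernel {n : ℕ} {φ : X → Y} (hφ : Measurable φ) (e : ι ⊕ κ ≃ Fin n)
    (A : (ι → Y) → (ι → Bool) → (κ → Y) → (Y → Bool) → ℝ) :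
    Kernel (PartialDatabase X n) (BoolConcept X) where
  -- Privacy concerns arbitrary databases, so a missing label at a position meant to be labeled is
  -- read as `false`. Labels at the other positions are ignored.
  toFun S := ∑ f, ENNReal.ofReal (A (fun i => φ (S (e (Sum.inl i))).1)
    (fun i => (S (e (Sum.inl i))).2.getD false) (fun i => φ (S (e (Sum.inr i))).1) f) •
      Measure.dirac (BoolConcept.pullback hφ f)
  measurable' := by
    have hlab : Measurable fun l : Label => l.getD false := measurable_from_top
    have henc : Measurable fun S : PartialDatabase X n =>
        ((fun i => φ (S (e (Sum.inl i))).1, fun i => (S (e (Sum.inl i))).2.getD false,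
          fun i => φ (S (e (Sum.inr i))).1) : (ι → Y) × (ι → Bool) × (κ → Y)) := by
      refine Measurable.prodMk ?_ (Measurable.prodMk ?_ ?_)
      · exact measurable_pi_lambda _ fun i => hφ.comp (measurable_fst.comp (measurable_pi_apply _))
      · exact measurable_pi_lambda _ fun i =>
          hlab.comp (measurable_snd.comp (measurable_pi_apply _))
      · exact measurable_pi_lambda _ fun i => hφ.comp (measurable_fst.comp (measurable_pi_apply _))
    have hfin : Measurable fun p : (ι → Y) × (ι → Bool) × (κ → Y) =>
        ∑ f, ENNReal.ofReal (A p.1 p.2.1 p.2.2 f) •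
          Measure.dirac (BoolConcept.pullback hφ f) := Measurable.of_discrete
    exact hfin.comp henc

theorem mechanismKernel_apply {n : ℕ} {φ : X → Y} (hφ : Measurable φ) (e : ι ⊕ κ ≃ Fin n)
    (A : (ι → Y) → (ι → Bool) → (κ → Y) → (Y → Bool) → ℝ) (S : PartialDatabase X n)
    (F : Set (BoolConcept X)) :
    mechanismKernel hφ e A S F = ∑ f, ENNReal.ofReal (A (fun i => φ (S (e (Sum.inl i))).1)
      (fun i => (S (e (Sum.inl i))).2.getD false) (fun i => φ (S (e (Sum.inr i))).1) f) *
        F.indicator 1 (BoolConcept.pullback hφ f) := by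
  have hF : MeasurableSet F := trivial
  change (∑ f, ENNReal.ofReal _ • Measure.dirac (BoolConcept.pullback hφ f) : Measure _) F = _
  rw [Measure.finsetSum_apply]
  refine Finset.sum_congr rfl fun f _ => ?_
  rw [Measure.smul_apply, Measure.dirac_apply' _ hF, smul_eq_mul]

theorem isMarkovKernel_mechanismKernel {n : ℕ} {φ : X → Y} (hφ : Measurable φ)
    (e : ι ⊕ κ ≃ Fin n) {A : (ι → Y) → (ι → Bool) → (κ → Y) → (Y → Bool) → ℝ} {a b : ℝ}
    (hA : IsPrivateMechanism a b A) : IsMarkovKernel (mechanismKernel hφ e A) := by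
  refine ⟨fun S => ⟨?_⟩⟩
  rw [mechanismKernel_apply]
  simp only [Set.indicator_univ, Pi.one_apply, mul_one]
  rw [← ENNReal.ofReal_sum_of_nonneg fun f _ => hA.nonneg _ _ _ _, hA.sum_eq_one,
    ENNReal.ofReal_one]

theorem isDifferentiallyPrivate_mechanismKernel {n : ℕ} {φ : X → Y} (hφ : Measurable φ)
    (e : ι ⊕ κ ≃ Fin n) {A : (ι → Y) → (ι → Bool) → (κ → Y) → (Y → Bool) → ℝ} {ε : ℝ}
    (hA : IsPrivateMechanism (Real.exp ε) (Real.exp ε) A) :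
    IsDifferentiallyPrivate ε 0 (mechanismKernel hφ e A) := by
  rintro S₁ S₂ ⟨i₀, -, hS⟩ F -
  rw [mechanismKernel_apply, mechanismKernel_apply, ENNReal.ofReal_zero, add_zero, Finset.mul_sum]
  refine Finset.sum_le_sum fun f _ => ?_
  rw [← mul_assoc, ← ENNReal.ofReal_mul (Real.exp_pos ε).le]
  refine mul_le_mul_left (ENNReal.ofReal_le_ofReal ?_) _
  obtain ⟨j, rfl⟩ := e.surjective i₀
  obtain j | j := j
  · have h1 : ∀ i, S₁ (e (Sum.inr i)) = S₂ (e (Sum.inr i)) := fun i =>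
      hS _ fun h => Sum.inr_ne_inl (e.injective h)
    have h2 : ∀ i ≠ j, S₁ (e (Sum.inl i)) = S₂ (e (Sum.inl i)) := fun i hi =>
      hS _ fun h => hi (Sum.inl_injective (e.injective h))
    simp only [h1]
    exact hA.labeled j _ _ _ _ (fun i hi => by simp only [h2 i hi])
      (fun i hi => by simp only [h2 i hi]) _ _
  · have h1 : ∀ i, S₁ (e (Sum.inl i)) = S₂ (e (Sum.inl i)) := fun i =>
      hS _ fun h => Sum.inl_ne_inr (e.injective h)
    have h2 : ∀ i ≠ j, S₁ (e (Sum.inr i)) = S₂ (e (Sum.inr i)) := fun i hi =>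
      hS _ fun h => hi (Sum.inr_injective (e.injective h))
    simp only [h1]
    exact hA.unlabeled j _ _ _ _ (fun i hi => by simp only [h2 i hi]) _

variable [DecidableEq ι] [DecidableEq κ]

theorem lintegral_mechanismKernel_le {m k : ℕ} (μ : Measure X) [IsProbabilityMeasure μ]
    {φ : X → Y} (hφ : Measurable φ) (eι : ι ≃ Fin m) (eκ : κ ≃ Fin k)
    {A : (ι → Y) → (ι → Bool) → (κ → Y) → (Y → Bool) → ℝ} {a b α β : ℝ}
    (hA : IsPrivateMechanism a b A) (c : Y → Bool)
    (hacc : (iidMean (fun y => (μ.map φ).real {y}) fun x =>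
      iidMean (fun y => (μ.map φ).real {y}) fun v => ∑ f, A x (c ∘ x) v f *
        if α < massError (fun y => (μ.map φ).real {y}) f c then 1 else 0) ≤ β) :
    ∫⁻ x, mechanismKernel hφ ((eι.sumCongr eκ).trans finSumFinEquiv) A
        (partialSample m (BoolConcept.pullback hφ c) x)
        {h | α < genError μ (BoolConcept.pullback hφ c) h}
        ∂(Measure.pi fun _ : Fin (m + k) => μ) ≤ ENNReal.ofReal β := by
  set w : Y → ℝ := fun y => (μ.map φ).real {y} with hw
  set e : ι ⊕ κ ≃ Fin (m + k) := (eι.sumCongr eκ).trans finSumFinEquiv with he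
  have hinl : ∀ i, (e (Sum.inl i)).val < m := fun i => by simp [he]
  set g : (ι ⊕ κ → Y) → ℝ := fun X => ∑ f, A (X ∘ Sum.inl) (c ∘ (X ∘ Sum.inl)) (X ∘ Sum.inr) f *
    if α < massError w f c then 1 else 0 with hg
  have hg0 : ∀ X, 0 ≤ g X := fun X => Finset.sum_nonneg fun f _ =>
    mul_nonneg (hA.nonneg _ _ _ _) (by split_ifs <;> norm_num)
  have hker : ∀ x : Fin (m + k) → X, mechanismKernel hφ e A
      (partialSample m (BoolConcept.pullback hφ c) x)
      {h | α < genError μ (BoolConcept.pullback hφ c) h} =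
      ENNReal.ofReal (g ((fun i => φ (x i)) ∘ e)) := by
    intro x
    rw [mechanismKernel_apply, hg, ENNReal.ofReal_sum_of_nonneg fun f _ =>
      mul_nonneg (hA.nonneg _ _ _ _) (by split_ifs <;> norm_num)]
    refine Finset.sum_congr rfl fun f _ => ?_
    rw [ENNReal.ofReal_mul (hA.nonneg _ _ _ _)]
    congr 1
    · simp only [partialSample, hinl, if_true, Option.getD_some]
      rfl
    · by_cases h : α < massError w f c
      · rw [if_pos h, ENNReal.ofReal_one, Set.indicator_of_mem]
        · rfl
        · exact h.trans_eq (genError_pullback μ hφ c f).symm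
      · rw [if_neg h, ENNReal.ofReal_zero, Set.indicator_of_notMem]
        exact fun h' => h (h'.trans_eq (genError_pullback μ hφ c f))
  simp only [hker]
  rw [lintegral_comp_eq_iidMean μ hφ (g := fun x => g (x ∘ e)) fun _ => hg0 _,
    iidMean.comp_equiv e g, iidMean.sumElim]
  exact ENNReal.ofReal_le_ofReal hacc

end transfer

/-! ### What a probabilistic representation reveals about the represented class -/

section representation

variable {X : Type*} [MeasurableSpace X] {C : Set (BoolConcept X)} {r : ℕ}
  {H : Fin r → Finset (BoolConcept X)} {P : PMF (Fin r)}

theorem isMass_toReal (P : PMF (Fin r)) : IsMass fun i => (P i).toReal where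
  nonneg _ := ENNReal.toReal_nonneg
  sum_eq_one := by
    have h := P.tsum_coe
    rw [tsum_fintype] at h
    rw [← ENNReal.toReal_sum fun i _ => P.apply_ne_top i, h, ENNReal.toReal_one]

theorem IsProbRepresentation.le_sum (hrep : IsProbRepresentation (1 / 4) (1 / 4) C H P)
    {c : BoolConcept X} (hc : c ∈ C) (μ : Measure X) [IsProbabilityMeasure μ] {G : Finset (Fin r)}
    (hG : ∀ i ∉ G, ∀ h ∈ H i, 1 / 4 < genError μ c h) : 3 / 4 ≤ ∑ i ∈ G, (P i).toReal := by
  have h1 : P.toOuterMeasure {i | ∃ h ∈ H i, genError μ c h ≤ 1 / 4} ≤ P.toOuterMeasure G :=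
    measure_mono fun i ⟨h, hh, hle⟩ => by
      by_contra hi
      exact absurd hle (not_le.2 (hG i hi h hh))
  have h2 := (hrep c hc μ).trans h1
  rw [PMF.toOuterMeasure_apply_finset] at h2
  rw [← ENNReal.toReal_sum fun i _ => P.apply_ne_top i]
  refine (ENNReal.ofReal_le_iff_le_toReal ?_).1 (le_trans (ENNReal.ofReal_le_ofReal ?_) h2)
  · exact ENNReal.sum_ne_top.2 fun i _ => P.apply_ne_top i
  · norm_num

theorem genError_dirac (x : X) (c h : BoolConcept X) :
    genError (Measure.dirac x) c h = if h x ≠ c x then 1 else 0 := by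
  have hm : MeasurableSet {y | h y ≠ c y} :=
    (measurableSet_eq_fun h.measurable_toFun c.measurable_toFun).compl
  rw [genError, measureReal_def, Measure.dirac_apply' _ hm]
  by_cases hx : h x = c x <;> simp [hx]

theorem genError_sum_dirac {Y : Type*} [Fintype Y] {w : Y → ℝ} (hw : ∀ y, 0 ≤ w y) (σ : Y → X)
    (c h : BoolConcept X) :
    genError (∑ y, ENNReal.ofReal (w y) • Measure.dirac (σ y)) c h =
      massError w (h ∘ σ) (c ∘ σ) := by
  have hm : MeasurableSet {y | h y ≠ c y} :=
    (measurableSet_eq_fun h.measurable_toFun c.measurable_toFun).compl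
  rw [genError, measureReal_def, Measure.finsetSum_apply, ENNReal.toReal_sum]
  · refine Finset.sum_congr rfl fun y _ => ?_
    rw [Measure.smul_apply, Measure.dirac_apply' _ hm, smul_eq_mul, ENNReal.toReal_mul,
      ENNReal.toReal_ofReal (hw y)]
    by_cases hy : h (σ y) = c (σ y) <;> simp [hy]
  · intro y _
    rw [Measure.smul_apply, smul_eq_mul]
    exact ENNReal.mul_ne_top ENNReal.ofReal_ne_top (measure_ne_top _ _)

theorem isProbabilityMeasure_sum_dirac {Y : Type*} [Fintype Y] {w : Y → ℝ} (hw : IsMass w)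
    (σ : Y → X) : IsProbabilityMeasure (∑ y, ENNReal.ofReal (w y) • Measure.dirac (σ y)) := by
  refine ⟨?_⟩
  rw [Measure.finsetSum_apply]
  simp only [Measure.smul_apply, measure_univ, smul_eq_mul, mul_one]
  rw [← ENNReal.ofReal_sum_of_nonneg fun y _ => hw.nonneg y, hw.sum_eq_one, ENNReal.ofReal_one]

/-- Points that are not separated by the hypotheses of a representation are not separated by
the represented concepts. -/
theorem IsProbRepresentation.apply_eq (hrep : IsProbRepresentation (1 / 4) (1 / 4) C H P)
    {c : BoolConcept X} (hc : c ∈ C) {x x' : X} (hx : ∀ i, ∀ h ∈ H i, h x = h x') :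
    c x = c x' := by
  by_contra hne
  -- Under the uniform law on x and x', every hypothesis is right at exactly one of the two points
  -- and has error 1/2, so no index is good.
  have hw : IsMass fun _ : Bool => (1 / 2 : ℝ) := ⟨fun _ => by norm_num, by norm_num⟩
  set σ : Bool → X := fun b => if b then x else x' with hσ
  have := isProbabilityMeasure_sum_dirac hw σ
  have h := hrep.le_sum hc (∑ b, ENNReal.ofReal (1 / 2) • Measure.dirac (σ b)) (G := ∅) ?_
  · norm_num at h
  · intro i _ h hh
    rw [genError_sum_dirac hw.nonneg, massError, Fintype.sum_bool]
    have h1 := hx i h hh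
    have h2 : (σ true = x) ∧ (σ false = x') := by simp [hσ]
    simp only [Function.comp_apply, h2.1, h2.2, h1]
    revert hne
    cases c x <;> cases c x' <;> cases h x' <;> norm_num

/-- If every class had at most one hypothesis, the indices good for `c` and for `c'` under the point
mass at x would be disjoint events of probability at least 3/4 each. This lower bound lets additive
constants be absorbed into multiples of the representation dimension. -/
theorem IsProbRepresentation.log_two_le_familySize
    (hrep : IsProbRepresentation (1 / 4) (1 / 4) C H P) {c c' : BoolConcept X} (hc : c ∈ C)
    (hc' : c' ∈ C) {x : X} (hx : c x ≠ c' x) : ENNReal.ofReal (Real.log 2) ≤ familySize H := by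
  classical
  by_contra! hlt
  have hcard : ∀ i, (H i).card ≤ 1 := by
    intro i
    by_contra! h2
    refine absurd ((le_iSup (fun i => ENNReal.ofReal (Real.log (H i).card)) i).trans_lt hlt) ?_
    rw [not_lt]
    exact ENNReal.ofReal_le_ofReal (Real.log_le_log (by norm_num) (by exact_mod_cast h2))
  set G : BoolConcept X → Finset (Fin r) := fun c =>
    Finset.univ.filter fun i => ∃ h ∈ H i, h x = c x with hG
  have hGle : ∀ c ∈ C, 3 / 4 ≤ ∑ i ∈ G c, (P i).toReal := by
    intro c hc
    refine hrep.le_sum hc (Measure.dirac x) fun i hi h hh => ?_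
    rw [genError_dirac, if_pos]
    · norm_num
    · exact fun h' => hi (Finset.mem_filter.2 ⟨Finset.mem_univ _, h, hh, h'⟩)
  have hdisj : Disjoint (G c) (G c') := by
    rw [Finset.disjoint_left]
    intro i hi hi'
    obtain ⟨h, hh, h1⟩ := (Finset.mem_filter.1 hi).2
    obtain ⟨h', hh', h2⟩ := (Finset.mem_filter.1 hi').2
    rw [Finset.card_le_one.1 (hcard i) h hh h' hh'] at h1
    exact hx (h1.symm.trans h2)
  have h1 := Finset.sum_le_sum_of_subset_of_nonneg (Finset.subset_univ (G c ∪ G c'))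
    fun i _ _ => (isMass_toReal P).nonneg i
  rw [Finset.sum_union hdisj, (isMass_toReal P).sum_eq_one] at h1
  linarith [hGle c hc, hGle c' hc']

end representation

/-! ### Assembly of the learner on a measurable space -/

theorem BoolConcept.ext_apply {X : Type*} [MeasurableSpace X] {c c' : BoolConcept X}
    (h : ∀ x, c x = c' x) : c = c' := by
  cases c
  cases c'
  congr
  exact funext h

/-- A class with at most one concept is learned without any examples. -/
theorem exists_isPSSL_of_subsingleton {X : Type*} [MeasurableSpace X] {C : Set (BoolConcept X)}
    (hC : C.Subsingleton) {α β ε : ℝ} (hα : 0 < α) :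
    ∃ A : Kernel (PartialDatabase X 0) (BoolConcept X),
      IsMarkovKernel A ∧ IsPSSL α β ε 0 0 0 C A := by
  obtain ⟨c₀, hc₀⟩ : ∃ c₀ : BoolConcept X, ∀ c ∈ C, c = c₀ := by
    rcases C.eq_empty_or_nonempty with rfl | ⟨c₀, h⟩
    · exact ⟨⟨fun _ => false, measurable_const⟩, fun c hc => hc.elim⟩
    · exact ⟨c₀, fun c hc => hC hc h⟩
  refine ⟨Kernel.const _ (Measure.dirac c₀), inferInstance, ⟨le_rfl, fun c hc μ _ => ?_⟩,
    fun S₁ S₂ ⟨i, _⟩ => i.elim0⟩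
  have h0 : genError μ c₀ c₀ = 0 := by simp [genError]
  have h1 : ∀ x : Fin 0 → X, Kernel.const (PartialDatabase X 0) (Measure.dirac c₀)
      (partialSample 0 c x) {h | α < genError μ c h} = 0 := by
    intro x
    have hm : MeasurableSet {h | α < genError μ c h} := trivial
    rw [Kernel.const_apply, Measure.dirac_apply' _ hm, Set.indicator_of_notMem]
    rw [hc₀ c hc, Set.mem_ofPred_eq, h0]
    exact not_lt.2 hα.le
  simp only [h1, lintegral_zero, zero_le]

theorem exists_isPSSL {α β ε : ℝ} (hα : 0 < α) (hβ : 0 < β) (hε : 0 < ε) :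
    ∃ K₁ K₂ : ℝ≥0, ∀ (X : Type*) [MeasurableSpace X] (C : Set (BoolConcept X)), repDim C ≠ ⊤ →
      ∃ n m : ℕ, (m : ℝ≥0∞) ≤ (K₁ : ℝ≥0∞) * (vcDimension C : ℝ≥0∞) ∧
        (n : ℝ≥0∞) ≤ (K₂ : ℝ≥0∞) * repDim C ∧
        ∃ A : Kernel (PartialDatabase X n) (BoolConcept X),
          IsMarkovKernel A ∧ IsPSSL α β ε 0 n m C A := by
  classical
  obtain ⟨K₁, K₂, hK⟩ := exists_private_learner hα hβ hε
  refine ⟨K₁, K₂ * 2, fun X _ C htop => ?_⟩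
  by_cases hsub : C.Subsingleton
  · exact ⟨0, 0, by simp, by simp, exists_isPSSL_of_subsingleton hsub hα⟩
  obtain ⟨c₁, hc₁, c₂, hc₂, hne⟩ := Set.not_subsingleton_iff.1 hsub
  obtain ⟨x₀, hx₀⟩ : ∃ x, c₁ x ≠ c₂ x := by
    by_contra! h
    exact hne (BoolConcept.ext_apply h)
  have hlow : ENNReal.ofReal (Real.log 2) ≤ repDim C :=
    le_iInf fun _ => le_iInf fun _ => le_iInf fun _ => le_iInf fun h =>
      h.log_two_le_familySize hc₁ hc₂ hx₀
  have hlog2 : 0 < Real.log 2 := Real.log_pos (by norm_num)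
  have hpos : repDim C ≠ 0 := ((ENNReal.ofReal_pos.2 hlog2).trans_le hlow).ne'
  -- The infimum is positive and finite, so some representation has size below its double; the
  -- infimum need not be shown to be attained.
  have hlt : repDim C < 2 * repDim C := by
    rw [two_mul]
    exact ENNReal.lt_add_right htop hpos
  obtain ⟨r, H, P, hrep, hsize⟩ : ∃ (r : ℕ) (H : Fin r → Finset (BoolConcept X)) (P : PMF (Fin r)),
      IsProbRepresentation (1 / 4) (1 / 4) C H P ∧ familySize H < 2 * repDim C := by
    conv_lhs at hlt => rw [repDim]
    simp only [iInf_lt_iff] at hlt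
    obtain ⟨r, H, P, hrep, h⟩ := hlt
    exact ⟨r, H, P, hrep, h⟩
  set L : ℝ := 2 * (repDim C).toReal with hL
  have hLtwo : 1 / 2 ≤ L := by
    have h := (ENNReal.ofReal_le_iff_le_toReal htop).1 hlow
    linarith [Real.log_two_gt_d9]
  have hcard : ∀ i, ((H i).card : ℝ) ≤ Real.exp L := by
    intro i
    rcases Nat.eq_zero_or_pos (H i).card with h0 | h0
    · rw [h0, Nat.cast_zero]
      exact (Real.exp_pos _).le
    · rw [← Real.log_le_iff_le_exp (by exact_mod_cast h0)]
      have h := ((le_iSup (fun i => ENNReal.ofReal (Real.log (H i).card)) i).trans hsize.le)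
      rw [ENNReal.ofReal_le_iff_le_toReal (ENNReal.mul_ne_top (by simp) htop)] at h
      simpa [hL] using h
  -- The finite domain: a point is replaced by the vector of its values under all hypotheses of the
  -- representation. The section σ picks one point of X for each vector that occurs.
  set φ₀ : X → {h // h ∈ Finset.univ.biUnion H} → Bool := fun x h => h.1 x with hφ₀
  have : Fintype (Set.range φ₀) := Fintype.ofFinite _
  set φ : X → Set.range φ₀ := Set.rangeFactorization φ₀ with hφdef
  have hφ : Measurable φ :=
    (measurable_pi_lambda _ fun h => h.1.measurable_toFun).subtype_mk
  obtain ⟨σ, hσ⟩ := (Set.rangeFactorization_surjective (f := φ₀)).hasRightInverse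
  have hσinj : Function.Injective σ := hσ.injective
  have hH : ∀ x, ∀ i, ∀ h ∈ H i, h (σ (φ x)) = h x := fun x i h hh =>
    congrFun (congrArg Subtype.val (hσ (φ x)))
      ⟨h, Finset.mem_biUnion.2 ⟨i, Finset.mem_univ _, hh⟩⟩
  have hCσ : ∀ c ∈ C, c = BoolConcept.pullback hφ (c ∘ σ) := fun c hc =>
    BoolConcept.ext_apply fun x => (hrep.apply_eq hc (hH x)).symm
  -- Empty classes are replaced by a singleton, since the exponential mechanism needs a candidate.
  -- Their indices are never good for the original representation, so nothing is lost.
  set H' : Fin r → Finset (Set.range φ₀ → Bool) := fun i =>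
    if (H i).Nonempty then (H i).image (fun h : BoolConcept X => h.toFun ∘ σ) else {fun _ => false} with hH'
  have hH'ne : ∀ i, (H' i).Nonempty := by
    intro i
    by_cases h : (H i).Nonempty
    · simp only [hH', if_pos h]
      exact h.image _
    · simp only [hH', if_neg h]
      exact Finset.singleton_nonempty _
  have hH'card : ∀ i, ((H' i).card : ℝ) ≤ Real.exp L := by
    intro i
    by_cases h : (H i).Nonempty
    · simp only [hH', if_pos h]
      exact le_trans (by exact_mod_cast Finset.card_image_le) (hcard i)
    · simp only [hH', if_neg h, Finset.card_singleton, Nat.cast_one]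
      exact Real.one_le_exp (by linarith)
  have hrep' : IsMassRepresentation ((fun c : BoolConcept X => c ∘ σ) '' C) H'
      fun i => (P i).toReal := by
    rintro _ ⟨c, hc, rfl⟩ w hw G hG
    have := isProbabilityMeasure_sum_dirac hw σ
    refine hrep.le_sum hc (∑ y, ENNReal.ofReal (w y) • Measure.dirac (σ y)) fun i hi h hh => ?_
    rw [genError_sum_dirac hw.nonneg]
    refine hG i hi _ ?_
    have hne : (H i).Nonempty := ⟨h, hh⟩
    simp only [hH', if_pos hne]
    exact Finset.mem_image_of_mem (fun h : BoolConcept X => h.toFun ∘ σ) hh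
  -- The point at which two concepts differ is shattered, so the sample bound τd is meaningful.
  have hVC1 : 1 ≤ vcDimension C := by
    have hsh : IsShattered C {x₀} := by
      intro z
      simp only [Finset.mem_singleton, forall_eq]
      by_cases h : c₁ x₀ = z x₀
      · exact ⟨c₁, hc₁, h⟩
      · refine ⟨c₂, hc₂, ?_⟩
        revert h hx₀
        cases c₁ x₀ <;> cases c₂ x₀ <;> cases z x₀ <;> simp
    have h := le_iSup₂ (f := fun (B : Finset X) (_ : IsShattered C B) => (B.card : ℕ∞)) {x₀} hsh
    simpa [vcDimension] using h
  have hVC : ∀ B : Finset (Set.range φ₀), (∀ z : Set.range φ₀ → Bool,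
      ∃ c ∈ (fun c : BoolConcept X => c ∘ σ) '' C, ∀ b ∈ B, c b = z b) →
      (B.card : ℕ∞) ≤ vcDimension C := by
    intro B hB
    have hsh : IsShattered C (B.image σ) := by
      intro z
      obtain ⟨_, ⟨c, hc, rfl⟩, h⟩ := hB (z ∘ σ)
      refine ⟨c, hc, fun b hb => ?_⟩
      obtain ⟨y, hy, rfl⟩ := Finset.mem_image.1 hb
      exact h y hy
    have h := le_iSup₂ (f := fun (B : Finset X) (_ : IsShattered C B) => (B.card : ℕ∞)) _ hsh
    rwa [Finset.card_image_of_injective _ hσinj] at h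
  obtain ⟨ι, κ, _, _, _, _, A, hι, hικ, hA, hacc⟩ := hK (Set.Nonempty.image _ ⟨c₁, hc₁⟩)
    (isMass_toReal P) hH'ne hrep' hLtwo hH'card hVC1 hVC
  set eι := Fintype.equivFin ι
  set eκ := Fintype.equivFin κ
  refine ⟨Fintype.card ι + Fintype.card κ, Fintype.card ι, ?_, ?_,
    mechanismKernel hφ ((eι.sumCongr eκ).trans finSumFinEquiv) A,
    isMarkovKernel_mechanismKernel hφ _ hA, ⟨Nat.le_add_right _ _, fun c hc μ _ => ?_⟩,
    isDifferentiallyPrivate_mechanismKernel hφ _ hA⟩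
  · have h := ENat.toENNReal_le.2 hι
    rw [ENat.toENNReal_mul] at h
    simpa using h
  · have h1 : ((Fintype.card ι + Fintype.card κ : ℕ) : ℝ≥0∞) ≤ ENNReal.ofReal (K₂ * L) := by
      rw [← ENNReal.ofReal_natCast]
      exact ENNReal.ofReal_le_ofReal (by exact_mod_cast hικ)
    refine h1.trans_eq ?_
    rw [hL, ← mul_assoc, ENNReal.ofReal_mul (by positivity), ENNReal.ofReal_toReal htop,
      ENNReal.ofReal_mul (by positivity)]
    simp
  · have h := lintegral_mechanismKernel_le μ hφ eι eκ hA (c ∘ σ)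
      (hacc _ ⟨c, hc, rfl⟩ _ (isMass_map μ hφ))
    rwa [← hCσ c hc] at h

theorem mainTheorem11 :
    ∃ K₁ K₂ : ℝ → ℝ → ℝ → ℝ≥0,
      ∀ (X : Type*) [MeasurableSpace X] (C : Set (BoolConcept X)), repDim C ≠ ⊤ →
        ∀ α β ε : ℝ, 0 < α → 0 < β → 0 < ε →
          ∃ n m : ℕ,
            (m : ℝ≥0∞) ≤ (K₁ α β ε : ℝ≥0∞) * (vcDimension C : ℝ≥0∞) ∧
            (n : ℝ≥0∞) ≤ (K₂ α β ε : ℝ≥0∞) * repDim C ∧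
            ∃ A : Kernel (PartialDatabase X n) (BoolConcept X),
              IsMarkovKernel A ∧ IsPSSL α β ε 0 n m C A := by
  have h : ∀ α β ε : ℝ, ∃ K₁ K₂ : ℝ≥0, 0 < α → 0 < β → 0 < ε →
      ∀ (X : Type _) [MeasurableSpace X] (C : Set (BoolConcept X)), repDim C ≠ ⊤ →
        ∃ n m : ℕ, (m : ℝ≥0∞) ≤ (K₁ : ℝ≥0∞) * (vcDimension C : ℝ≥0∞) ∧
          (n : ℝ≥0∞) ≤ (K₂ : ℝ≥0∞) * repDim C ∧
          ∃ A : Kernel (PartialDatabase X n) (BoolConcept X),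
            IsMarkovKernel A ∧ IsPSSL α β ε 0 n m C A := by
    intro α β ε
    by_cases h : 0 < α ∧ 0 < β ∧ 0 < ε
    · obtain ⟨K₁, K₂, hK⟩ := exists_isPSSL h.1 h.2.1 h.2.2
      exact ⟨K₁, K₂, fun _ _ _ => hK⟩
    · exact ⟨0, 0, fun hα hβ hε => absurd ⟨hα, hβ, hε⟩ h⟩
  choose K₁ K₂ hK using h
  exact ⟨K₁, K₂, fun X _ C hC α β ε hα hβ hε => hK α β ε hα hβ hε X C hC⟩
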